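/- **Setting.** Let $G$ be a connected undirected simple graph on $[c]=\{1,\dots,c\}$ with adjacency matrix $\widetilde W$, and let $\pi$ be the stationary distribution of the simple random walk on $G$. Let $W$ have entries $w_{x,y}=\widetilde w_{x,y}\pi_x\pi_y$, let $d_x=\sum_y w_{x,y}$, $D=\operatorname{diag}(d)$ and $M=D^{-1/2}WD^{-1/2}$. Let $(x_k)_{k\ge1}$ be the random token sequence with $x_k=k$ for $k\le c$, such that $x_{c+1}, x_{c+2},\dots$ is a simple random walk on $G$ with $x_{c+1}\sim\pi$. Put $F_{y,k}=\#\{j\le k: x_j=y\}$. Matrix norms are Frobenius norms. *Attention maps.* A matrix $A=(a_{k,j})\in\mathbb R_{\ge 0}^{n\times n}$ is an attention map if it is lower triangular with row sums $1$. It is nice with parameter $\psi>0$ if moreover $\sum_{i\le j}a_{k,i}\le \psi j/k$ for all $j\le k\le n$. A nice attention map with parameter $\psi$ reflects $f:[c]\to 2^{[c]}$ if for all $k>c$ and $j\le k$, $a_{k,j}>0$ implies $x_j\in f(x_k)$, and for all $k\le n$ and $y\in f(x_k)$, $$\Big|\sum_{j\le k}a_{k,j}\mathbf 1_{\{x_j=y\}}-\frac{F_{y,k}}{\sum_{y'\in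 f(x_k)}F_{y',k}}\Big|\le\frac{\psi}{\sqrt k}$$ (with $0/0=0$). *Great mappings.* For $\gamma_1,\gamma_2>0$ and a matrix $U$ with $c$ rows and orthonormal columns, $\sigma:\mathbb R^d\to\mathbb R^d$ is a great mapping w.r.t. $(\gamma_1,\gamma_2,\mathbb R^{d\times c},U)$ if for every $Z\in\mathbb R^{d\times c}$, $\gamma_1\|ZD^{1/2}U\|\le\|\sigma(Z)D^{1/2}U\|\le\gamma_2\|ZD^{1/2}U\|$, where $\sigma$ acts on columns. *Spectral gap ratio.* For a symmetric $S\in\mathbb R^{c\times c}$ with eigenvalues ordered so that $|\lambda_1(S)|\ge\dots\ge|\lambda_c(S)|$, let $\delta_q(S)=|\lambda_{q+1}(S)|/|\lambda_q(S)|$ when $\lambda_q(S)\neq0$. **Theorem.** There is an event of probability at least $0.99$, depending only on the token sequence's probability space (not on any of the data below), on which the following holds. Let $2\le q<c$, and let $$M=\begin{bmatrix}f_1&X&Y\end{bmatrix}\operatorname{diag}(\lambda_1,\dots,\lambda_c)\begin{bmatrix}f_1&X&Y\end{bmatrix}^{\top}$$ be an orthogonal eigendecomposition with $\lambda_1=1$,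 where $X$ contains the columns $2,\dots,q$ and $Y$ the columns $q+1,\dots,c$. For each layer $\ell\ge1$ let $\rho_A^{(\ell)},\rho_B^{(\ell)},\rho_O^{(\ell)},\rho_T^{(\ell)}\ge0$ have sum $1$, and suppose that the first $q$ eigenvectors are leading for $\rho_A^{(\ell)}I+\rho_B^{(\ell)}M$, that is, $|\rho_A^{(\ell)}+\rho_B^{(\ell)}\lambda_i|\ge|\rho_A^{(\ell)}+\rho_B^{(\ell)}\lambda_j|$ whenever $i\le q<j$. For every $n>10c$ and $\ell\ge1$ let the $n\times n$ attention map be $$A^{(\ell)}=\rho_A^{(\ell)}A^{(\ell,A)}+\rho_B^{(\ell)}A^{(\ell,B)}+\rho_O^{(\ell)}A^{(\ell,O)}+\rho_T^{(\ell)}A^{(T)},$$ where $A^{(\ell,A)},A^{(\ell,B)},A^{(\ell,O)}$ are nice attention maps with parameters $\psi_A^{(\ell)},\psi_B^{(\ell)},\psi_O^{(\ell)}$ (independent of $n$) that reflect, respectively, $x\mapsto\{x\}$, $x\mapsto\{y:\widetilde w_{x,y}>0\}$, $x\mapsto[c]$, and where every row of $A^{(T)}$ is $(1,0,\dots,0)$.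 Given token vectors $b_1,\dots,b_c\in\mathbb R^d$ and maps $\sigma^{(\ell)}:\mathbb R^d\to\mathbb R^d$, let $v_k^{(1)}=b_{x_k}$ and $v_k^{(\ell+1)}=\sigma^{(\ell)}\big(\sum_{j\le k}a^{(\ell)}_{k,j}v_j^{(\ell)}\big)$ for $k\le n$. Let $B=[b_1\,\cdots\,b_c]$ and suppose $BD^{1/2}X\ne0$. Suppose that each $\sigma^{(\ell)}$ is Lipschitz and a great mapping w.r.t. $(\gamma_1^{(\ell)},\gamma_2^{(\ell)},\mathbb R^{d\times c},X)$ and $(\gamma_1'^{(\ell)},\gamma_2'^{(\ell)},\mathbb R^{d\times c},Y)$, and that there is $\epsilon>0$ such that for all $\ell$, $\lambda_q\big(\rho_A^{(\ell)}I+\rho_B^{(\ell)}M\big)\ne0$ and $$\delta_q\big(\rho_A^{(\ell)}I+\rho_B^{(\ell)}M\big)\,\frac{\gamma_2'^{(\ell)}}{\gamma_1^{(\ell)}}\le1-\epsilon .$$ Let $n_{[x]}$ be the largest $k\le n$ with $x_k=x$, and let $V_n^{(L)}$ be the $d\times c$ matrix with columns $v^{(L)}_{n_{[x]}}$, $x\in[c]$.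 Then for every $L\ge1$ one has $\|V_n^{(L)}D^{1/2}X\|\neq0$ for all large $n$, the inner limit below exists and is finite, and $$\lim_{L\to\infty}\lim_{n\to\infty}\frac{\|V_n^{(L)}D^{1/2}Y\|}{\|V_n^{(L)}D^{1/2}X\|}=0 .$$ -/

import Mathlib

open MeasureTheory Filter Topology

-- Norms of matrices are Frobenius norms.
attribute [local instance] Matrix.frobeniusNormedAddCommGroup

noncomputable section

namespace DoubleConvergence

/-! ### The graph and its spectral data -/

section Graph

variable {c : ℕ} (G : SimpleGraph (Fin c)) [DecidableRel G.Adj]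

/-- Transition matrix of the simple random walk on `G`: from `x`, move to a uniformly chosen
neighbor of `x`. -/
def transition (x y : Fin c) : ℝ := G.adjMatrix ℝ x y / G.degree x

/-- `π` is a stationary distribution of the simple random walk on `G`. -/
structure IsStationaryDist (π : Fin c → ℝ) : Prop where
  nonneg : ∀ x, 0 ≤ π x
  sum_eq_one : ∑ x, π x = 1
  invariant : ∀ y, ∑ x, π x * transition G x y = π y

/-- The reweighted adjacency matrix `w x y = w̃ x y * π x * π y`. -/
def reweighted (π : Fin c → ℝ) : Matrix (Fin c) (Fin c) ℝ :=
  Matrix.of fun x y => G.adjMatrix ℝ x y * π x * π y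

/-- The degree `d x` of the reweighted graph. -/
def rdegree (π : Fin c → ℝ) (x : Fin c) : ℝ := ∑ y, reweighted G π x y

/-- `D ^ (1/2)`. -/
def sqrtDeg (π : Fin c → ℝ) : Matrix (Fin c) (Fin c) ℝ :=
  Matrix.diagonal fun x => √(rdegree G π x)

/-- `M = D ^ (-1/2) * W * D ^ (-1/2)`. -/
def normAdj (π : Fin c → ℝ) : Matrix (Fin c) (Fin c) ℝ :=
  Matrix.diagonal (fun x => (√(rdegree G π x))⁻¹) * reweighted G π *
    Matrix.diagonal (fun x => (√(rdegree G π x))⁻¹)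

/-- The token process. Position `i` here is position `i + 1` in one-based numbering: the first `c`
tokens traverse the vocabulary, and from the next one on the tokens form a simple random walk on
`G` started from `π`. -/
structure IsTokenProcess (π : Fin c → ℝ) {Ω : Type*} [MeasurableSpace Ω] (P : Measure Ω)
    (x : ℕ → Ω → Fin c) : Prop where
  measurable : ∀ i, Measurable (x i)
  traversal : ∀ y : Fin c, ∀ᵐ ω ∂P, x y ω = y
  walk : ∀ (m : ℕ) (y : ℕ → Fin c),
    P.real {ω | ∀ i ≤ m, x (c + i) ω = y i} =
      π (y 0) * ∏ i ∈ Finset.range m, transition G (y i) (y (i + 1))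

end Graph

/-- The `k`-th largest (`k = 1, 2, …`) absolute value of an eigenvalue of a symmetric matrix,
eigenvalues being counted with multiplicity. -/
def absEigenvalue {c : ℕ} (S : Matrix (Fin c) (Fin c) ℝ) (k : ℕ) : ℝ :=
  ((S.charpoly.roots.map fun t : ℝ => |t|).sort (· ≥ ·)).getD (k - 1) 0

/-- The spectral gap ratio `|λ_{q+1}| / |λ_q|`, where `|λ_1| ≥ |λ_2| ≥ …`. -/
def gapRatio {c : ℕ} (q : ℕ) (S : Matrix (Fin c) (Fin c) ℝ) : ℝ :=
  absEigenvalue S (q + 1) / absEigenvalue S q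

/-- `S = Q * diag lam * Qᵀ` with `Q` orthogonal, the first eigenvalue being `1`. -/
structure IsEigendecomposition {c : ℕ} (S Q : Matrix (Fin c) (Fin c) ℝ) (lam : Fin c → ℝ) :
    Prop where
  orthogonal : Q.transpose * Q = 1
  eq : S = Q * Matrix.diagonal lam * Q.transpose
  first : ∀ i : Fin c, (i : ℕ) = 0 → lam i = 1

/-- The block `X`: columns number `2, …, q` of `Q` in one-based numbering. -/
def blockX {c : ℕ} (q : ℕ) (Q : Matrix (Fin c) (Fin c) ℝ) :
    Matrix (Fin c) {i : Fin c // 1 ≤ (i : ℕ) ∧ (i : ℕ) < q} ℝ :=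
  Q.submatrix id Subtype.val

/-- The block `Y`: columns number `q + 1, …, c` of `Q` in one-based numbering. -/
def blockY {c : ℕ} (q : ℕ) (Q : Matrix (Fin c) (Fin c) ℝ) :
    Matrix (Fin c) {i : Fin c // q ≤ (i : ℕ)} ℝ :=
  Q.submatrix id Subtype.val

/-! ### Attention maps

Indices `k j : Fin n` stand for the one-based positions `k + 1`, `j + 1`. -/

/-- Lower-triangular, row-stochastic, with nonnegative entries. -/
structure IsAttentionMap {n : ℕ} (A : Matrix (Fin n) (Fin n) ℝ) : Prop where
  nonneg : ∀ k j, 0 ≤ A k j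
  lower : ∀ k j, k < j → A k j = 0
  row_sum : ∀ k, ∑ j, A k j = 1

structure IsNiceAttention {n : ℕ} (A : Matrix (Fin n) (Fin n) ℝ) (ψ : ℝ) : Prop
    extends IsAttentionMap A where
  pos : 0 < ψ
  nice : ∀ k j, j ≤ k → ∑ i ∈ Finset.Iic j, A k i ≤ ψ * ((j : ℕ) + 1) / ((k : ℕ) + 1)

/-- Number of occurrences of the token `y` at the positions `0, …, k`. -/
def freq {c : ℕ} (x : ℕ → Fin c) (k : ℕ) (y : Fin c) : ℕ :=
  ((Finset.range (k + 1)).filter fun j => x j = y).card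

/-- `A` is a nice attention map with parameter `ψ` that reflects `f`. If no token of `f (x k)` has
occurred up to position `k` (possible only for `k < c`), both terms of the difference in `balanced`
are `0`. -/
structure Reflects {c n : ℕ} (x : ℕ → Fin c) (A : Matrix (Fin n) (Fin n) ℝ) (ψ : ℝ)
    (f : Fin c → Finset (Fin c)) : Prop extends IsNiceAttention A ψ where
  support : ∀ k j : Fin n, c ≤ (k : ℕ) → j ≤ k → 0 < A k j → x j ∈ f (x k)
  balanced : ∀ k : Fin n, ∀ y ∈ f (x k),
    |(∑ j ∈ Finset.Iic k, A k j * (if x j = y then 1 else 0)) -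
        (freq x k y : ℝ) / ∑ y' ∈ f (x k), (freq x k y' : ℝ)| ≤ ψ / √((k : ℕ) + 1)

/-- The attention sink: every position attends to the first one only. -/
def sinkAttention (n : ℕ) : Matrix (Fin n) (Fin n) ℝ :=
  Matrix.of fun _ j => if (j : ℕ) = 0 then 1 else 0

/-- `A` is the combination, with weights `ρA, ρB, ρO, ρT`, of attention maps of the four types self
(A), neighbor (B), other (O), sink (T). -/
def IsMixedAttention {c n : ℕ} (G : SimpleGraph (Fin c)) [DecidableRel G.Adj] (x : ℕ → Fin c)
    (ρA ρB ρO ρT ψA ψB ψO : ℝ) (A : Matrix (Fin n) (Fin n) ℝ) : Prop :=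
  ∃ AA AB AO : Matrix (Fin n) (Fin n) ℝ,
    Reflects x AA ψA (fun y => {y}) ∧
    Reflects x AB ψB (fun y => G.neighborFinset y) ∧
    Reflects x AO ψO (fun _ => Finset.univ) ∧
    A = ρA • AA + ρB • AB + ρO • AO + ρT • sinkAttention n

/-! ### The model -/

/-- The hidden representations. Layer `ℓ` here is layer `ℓ + 1` in one-based numbering. -/
def hiddenRep {c d n : ℕ} (x : ℕ → Fin c) (b : Fin c → EuclideanSpace ℝ (Fin d))
    (A : ℕ → Matrix (Fin n) (Fin n) ℝ)
    (σ : ℕ → EuclideanSpace ℝ (Fin d) → EuclideanSpace ℝ (Fin d)) :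
    ℕ → Fin n → EuclideanSpace ℝ (Fin d)
  | 0, k => b (x k)
  | ℓ + 1, k => σ ℓ (∑ j ∈ Finset.Iic k, A ℓ k j • hiddenRep x b A σ ℓ j)

/-- Column-wise stacking of vectors. -/
def mat {c d : ℕ} (z : Fin c → EuclideanSpace ℝ (Fin d)) : Matrix (Fin d) (Fin c) ℝ :=
  Matrix.of fun i x => z x i

/-- Apply a map to each column of a matrix. -/
def colMap {c d : ℕ} (σ : EuclideanSpace ℝ (Fin d) → EuclideanSpace ℝ (Fin d))
    (Z : Matrix (Fin d) (Fin c) ℝ) : Matrix (Fin d) (Fin c) ℝ :=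
  mat fun x => σ (WithLp.toLp 2 (Z.col x))

/-- The matrix whose `y`-th column is the vector `v k` at the last position `k < n` with token `y`
(such a position exists as soon as the first `c` tokens traverse the vocabulary and `c ≤ n`). -/
def lastOcc {c d n : ℕ} (x : ℕ → Fin c) (v : Fin n → EuclideanSpace ℝ (Fin d)) :
    Matrix (Fin d) (Fin c) ℝ :=
  mat fun y =>
    if h : (Finset.univ.filter fun k : Fin n => x k = y).Nonempty then
      v ((Finset.univ.filter fun k : Fin n => x k = y).max' h)
    else 0

/-- `σ` is a great mapping with respect to `(γ₁, γ₂, 𝒵, U)`; `H` is the matrix `D ^ (1/2)`. -/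
structure IsGreatMapping {c d : ℕ} {p : Type*} [Fintype p] (H : Matrix (Fin c) (Fin c) ℝ)
    (σ : EuclideanSpace ℝ (Fin d) → EuclideanSpace ℝ (Fin d)) (γ₁ γ₂ : ℝ)
    (𝒵 : Set (Matrix (Fin d) (Fin c) ℝ)) (U : Matrix (Fin c) p ℝ) : Prop where
  pos₁ : 0 < γ₁
  pos₂ : 0 < γ₂
  lower : ∀ Z ∈ 𝒵, γ₁ * ‖Z * H * U‖ ≤ ‖colMap σ Z * H * U‖
  upper : ∀ Z ∈ 𝒵, ‖colMap σ Z * H * U‖ ≤ γ₂ * ‖Z * H * U‖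

end DoubleConvergence

end

open DoubleConvergence

/-!
The ratio of norms is governed by a finite-dimensional limit dynamics, obtained by letting the number
of positions tend to infinity in a fixed layer, and this dynamics contracts the ratio by a fixed
factor in every layer.

*The event.* It is the almost sure event on which the empirical frequencies of the tokens tend to the
stationary distribution `π` (`IsTokenProcess.ae_tendsto_freq`). The walk may be periodic, so instead
of mixing the proof uses a solution `h` of the Poisson equation `h - T h = 1_y - π y`
(`IsStationaryDist.exists_poisson`), which exists because harmonic functions on a connected graph are
constant. Up to a bounded error the centered number of visits to `y` is then a martingale with bounded
increments; its second moment grows linearly, so after division by the time it tends to zero almost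
surely along the squares, hence along all times.

*The limit in the positions.* In every layer the vector at position `k` is asymptotically a function
of the token at `k`, uniformly in the number of positions (`TokenLimit`). This property is inherited
by the next layer: a nice attention map puts little weight on early positions, and a map that
reflects `f` turns the limits `u` into averages of `u` over `f` with weights proportional to `π`
(`TokenLimit.reflects`). The first position keeps attending to itself, so the sink contributes a
constant vector. Since every token occurs infinitely often, the matrices of last occurrences converge
(`TokenLimit.tendsto_lastOcc`).

*The contraction.* With `U` the matrix of limits, averaging over neighbors replaces `U D^(1/2)` by
`U D^(1/2) M`, whereas the average over all tokens and the sink add a matrix whose rows are multiples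
of `√d`. The vector `√d` spans the eigenspace of `M` for the simple eigenvalue `1`, so it is
orthogonal to `X` and `Y`. Hence in the eigenbasis the attention step multiplies each column by an
eigenvalue of `ρA I + ρB M` (`IsEigendecomposition.limitInput_mul`), and together with the bounds on
`σ` the ratio shrinks by the factor `δ_q γ₂' / γ₁ ≤ 1 - ε` (`IsEigendecomposition.layer_contraction`).
-/

/-! ### Harmonic functions and stationary distributions on connected graphs -/

/-- Maximum principle: a function that equals a weighted average of its values at the neighbors is
constant on a connected graph. -/
theorem SimpleGraph.Connected.eq_of_weighted_harmonic {V : Type*} [Fintype V] {G : SimpleGraph V}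
    (hG : G.Connected) {a : V → V → ℝ} (ha : ∀ x y, 0 ≤ a x y) (hadj : ∀ x y, G.Adj x y → 0 < a x y)
    {f : V → ℝ} (hf : ∀ x, ∑ y, a x y * f y = (∑ y, a x y) * f x) (x y : V) : f x = f y := by
  have : Nonempty V := hG.nonempty
  obtain ⟨m, hm⟩ := Finite.exists_max f
  have step : ∀ x y, G.Adj x y → f x = f m → f y = f m := by
    intro x y hxy hx
    have h0 : ∑ z, a x z * (f m - f z) = 0 := by
      simp only [mul_sub, Finset.sum_sub_distrib, hf x, ← Finset.sum_mul, hx, sub_self]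
    have h1 := (Finset.sum_eq_zero_iff_of_nonneg fun z _ =>
      mul_nonneg (ha x z) (sub_nonneg.2 (hm z))).1 h0 y (Finset.mem_univ _)
    rcases mul_eq_zero.1 h1 with h | h
    · exact absurd h (hadj x y hxy).ne'
    · linarith
  have all : ∀ z, f z = f m := by
    intro z
    obtain ⟨p⟩ := hG.preconnected m z
    have : ∀ {u v : V} (p : G.Walk u v), f u = f m → f v = f m := by
      intro u v p
      induction p with
      | nil => exact id
      | cons h _ ih => exact fun hu => ih (step _ _ h hu)
    exact this p rfl
  rw [all x, all y]

theorem SimpleGraph.Connected.exists_adj_of_two_le {c : ℕ} {G : SimpleGraph (Fin c)}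
    (hG : G.Connected) (hc : 2 ≤ c) (x : Fin c) : ∃ y, G.Adj x y := by
  have : Nontrivial (Fin c) := Fin.nontrivial_iff_two_le.2 hc
  exact hG.preconnected.exists_adj_of_nontrivial x

namespace DoubleConvergence

section Graph

variable {c : ℕ} {G : SimpleGraph (Fin c)} [DecidableRel G.Adj] {π : Fin c → ℝ}

theorem transition_nonneg (x y : Fin c) : 0 ≤ transition G x y := by
  unfold transition
  rw [SimpleGraph.adjMatrix_apply]
  positivity

theorem transition_pos {x y : Fin c} (h : G.Adj x y) : 0 < transition G x y := by
  have : 0 < G.degree x := (G.degree_pos_iff_exists_adj x).2 ⟨y, h⟩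
  unfold transition
  rw [SimpleGraph.adjMatrix_apply, if_pos h]
  positivity

theorem sum_transition (hG : G.Connected) (hc : 2 ≤ c) (x : Fin c) :
    ∑ y, transition G x y = 1 := by
  have h : 0 < G.degree x := (G.degree_pos_iff_exists_adj x).2 (hG.exists_adj_of_two_le hc x)
  have h' : ∑ y, G.adjMatrix ℝ x y = G.degree x := by
    simp [SimpleGraph.adjMatrix_apply, ← SimpleGraph.card_neighborFinset_eq_degree,
      SimpleGraph.neighborFinset_eq_filter]
  unfold transition
  rw [← Finset.sum_div, h', div_self (by positivity)]

theorem IsStationaryDist.pos (hπ : IsStationaryDist G π) (hG : G.Connected) (x : Fin c) :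
    0 < π x := by
  obtain ⟨m, hm⟩ : ∃ m, 0 < π m := by
    by_contra! h
    have := hπ.sum_eq_one
    rw [Finset.sum_eq_zero fun x _ => le_antisymm (h x) (hπ.nonneg x)] at this
    exact zero_ne_one this
  obtain ⟨p⟩ := hG.preconnected m x
  have : ∀ {u v : Fin c} (p : G.Walk u v), 0 < π u → 0 < π v := by
    intro u v p
    induction p with
    | nil => exact id
    | @cons u v w h _ ih =>
      refine fun hu => ih ?_
      rw [← hπ.invariant v]
      exact (mul_pos hu (transition_pos h)).trans_le
        (Finset.single_le_sum (f := fun x => π x * transition G x v)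
          (fun z _ => mul_nonneg (hπ.nonneg z) (transition_nonneg z v)) (Finset.mem_univ u))
  exact this p hm

/-- The Poisson equation of the random walk can be solved for the centered indicator of a vertex:
`f ↦ f - T f + π(f)` is injective by the maximum principle, hence surjective. -/
theorem IsStationaryDist.exists_poisson (hπ : IsStationaryDist G π) (hG : G.Connected)
    (hc : 2 ≤ c) (y : Fin c) :
    ∃ h : Fin c → ℝ, ∀ x, h x - ∑ z, transition G x z * h z = (if x = y then 1 else 0) - π y := by
  let Φ : (Fin c → ℝ) →ₗ[ℝ] (Fin c → ℝ) :=
    { toFun := fun f x => f x - ∑ z, transition G x z * f z + ∑ z, π z * f z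
      map_add' := by
        intro f g
        ext x
        simp only [Pi.add_apply, mul_add, Finset.sum_add_distrib]
        ring
      map_smul' := by
        intro r f
        ext x
        simp only [Pi.smul_apply, smul_eq_mul, RingHom.id_apply, mul_add, mul_sub, Finset.mul_sum]
        congr 1
        · congr 1
          exact Finset.sum_congr rfl fun z _ => by ring
        · exact Finset.sum_congr rfl fun z _ => by ring }
  have hΦ : ∀ f, ∑ x, π x * Φ f x = ∑ z, π z * f z := by
    intro f
    have h1 : ∑ x, π x * ∑ z, transition G x z * f z = ∑ z, π z * f z := by
      simp only [Finset.mul_sum]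
      rw [Finset.sum_comm]
      refine Finset.sum_congr rfl fun z _ => ?_
      conv_rhs => rw [← hπ.invariant z, Finset.sum_mul]
      exact Finset.sum_congr rfl fun x _ => by ring
    change ∑ x, π x * (f x - ∑ z, transition G x z * f z + ∑ z, π z * f z) = _
    simp only [mul_add, mul_sub, Finset.sum_add_distrib, Finset.sum_sub_distrib, h1, sub_self,
      ← Finset.sum_mul, hπ.sum_eq_one, zero_add, one_mul]
  have hinj : Function.Injective Φ := by
    rw [← LinearMap.ker_eq_bot, LinearMap.ker_eq_bot']
    intro f hf
    have h0 : ∑ z, π z * f z = 0 := by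
      rw [← hΦ f, hf]
      simp
    have hharm : ∀ x, ∑ z, transition G x z * f z = (∑ z, transition G x z) * f x := by
      intro x
      have := congrFun hf x
      change f x - ∑ z, transition G x z * f z + ∑ z, π z * f z = 0 at this
      rw [sum_transition hG hc]
      linarith
    have hconst := hG.eq_of_weighted_harmonic (fun x y => transition_nonneg x y)
      (fun x y h => transition_pos h) hharm
    ext x
    have : ∑ z, π z * f z = f x := by
      rw [Finset.sum_congr rfl fun z _ => by rw [hconst z x], ← Finset.sum_mul, hπ.sum_eq_one,
        one_mul]
    rw [← this, h0, Pi.zero_apply]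
  obtain ⟨h, hh⟩ := LinearMap.injective_iff_surjective.1 hinj (fun x => if x = y then 1 else 0)
  refine ⟨h, fun x => ?_⟩
  have h1 : ∑ z, π z * h z = π y := by
    rw [← hΦ h, hh]
    simp
  have := congrFun hh x
  change h x - ∑ z, transition G x z * h z + ∑ z, π z * h z = _ at this
  rw [h1] at this
  rw [← this]
  ring

end Graph

end DoubleConvergence

/-! ### Empirical frequencies of the token process -/

/-- Functions whose squares have summable integrals tend to zero almost everywhere. -/
theorem MeasureTheory.ae_tendsto_zero_of_summable_integral_sq {Ω : Type*} [MeasurableSpace Ω]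
    {P : Measure Ω} {f : ℕ → Ω → ℝ} (hf : ∀ m, Measurable (f m))
    (hint : ∀ m, Integrable (fun ω => f m ω ^ 2) P) (hsum : Summable fun m => ∫ ω, f m ω ^ 2 ∂P) :
    ∀ᵐ ω ∂P, Tendsto (fun m => f m ω) atTop (𝓝 0) := by
  have hm : ∀ m, Measurable fun ω => ENNReal.ofReal (f m ω ^ 2) :=
    fun m => ((hf m).pow_const 2).ennreal_ofReal
  have hfin : ∫⁻ ω, ∑' m, ENNReal.ofReal (f m ω ^ 2) ∂P ≠ ⊤ := by
    rw [lintegral_tsum fun m => (hm m).aemeasurable]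
    have h1 : ∀ m, ∫⁻ ω, ENNReal.ofReal (f m ω ^ 2) ∂P = ENNReal.ofReal (∫ ω, f m ω ^ 2 ∂P) :=
      fun m => (ofReal_integral_eq_lintegral_ofReal (hint m)
        (Eventually.of_forall fun ω => sq_nonneg (f m ω))).symm
    simp only [h1]
    exact hsum.tsum_ofReal_ne_top
  filter_upwards [ae_lt_top (Measurable.tsum hm) hfin] with ω hω
  have h1 := ENNReal.tendsto_atTop_zero_of_tsum_ne_top hω.ne
  have h2 : Tendsto (fun m => f m ω ^ 2) atTop (𝓝 0) := by
    have := (ENNReal.tendsto_toReal ENNReal.zero_ne_top).comp h1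
    simpa [Function.comp_def, ENNReal.toReal_ofReal (sq_nonneg _)] using this
  have h3 := (Real.continuous_sqrt.tendsto 0).comp h2
  rw [tendsto_zero_iff_abs_tendsto_zero]
  simpa [Function.comp_def, Real.sqrt_sq_eq_abs] using h3

/-- A sequence with bounded increments is sublinear as soon as it is so along the squares. -/
theorem tendsto_div_of_tendsto_sq {M : ℕ → ℝ} {B : ℝ} (hB : ∀ k, |M (k + 1) - M k| ≤ B)
    (h : Tendsto (fun m : ℕ => M (m ^ 2) / (m : ℝ) ^ 2) atTop (𝓝 0)) :
    Tendsto (fun k : ℕ => M k / k) atTop (𝓝 0) := by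
  have hB0 : 0 ≤ B := (abs_nonneg _).trans (hB 0)
  have hinc : ∀ a r, |M (a + r) - M a| ≤ r * B := by
    intro a r
    induction r with
    | zero => simp
    | succ r ih =>
      have := abs_add_le (M (a + r + 1) - M (a + r)) (M (a + r) - M a)
      rw [sub_add_sub_cancel] at this
      have h2 := hB (a + r)
      rw [← add_assoc]
      push_cast
      linarith
  have hsqrt : Tendsto Nat.sqrt atTop atTop := by
    refine tendsto_atTop.2 fun b => ?_
    filter_upwards [eventually_ge_atTop (b * b)] with k hk
    exact Nat.le_sqrt.2 hk
  have hlim : Tendsto (fun k : ℕ => |M (k.sqrt ^ 2) / (k.sqrt : ℝ) ^ 2| + 2 * B * (k.sqrt : ℝ)⁻¹)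
      atTop (𝓝 0) := by
    have h1 := (h.comp hsqrt).abs
    have h2 := ((tendsto_inv_atTop_zero.comp
      (tendsto_natCast_atTop_atTop (R := ℝ))).comp hsqrt).const_mul (2 * B)
    simpa [Function.comp_def] using h1.add h2
  refine squeeze_zero_norm' ?_ hlim
  filter_upwards [eventually_ge_atTop 1] with k hk
  set m := k.sqrt with hm
  have hm1 : 1 ≤ m := Nat.le_sqrt.2 (by omega)
  have hle : m ^ 2 ≤ k := Nat.sqrt_le' k
  have hlt : k ≤ m ^ 2 + 2 * m := by
    have := Nat.sqrt_le_add k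
    rw [← hm] at this
    nlinarith
  clear_value m
  obtain ⟨r, rfl⟩ := Nat.exists_eq_add_of_le hle
  have hr : (r : ℝ) ≤ 2 * m := by exact_mod_cast (by omega : r ≤ 2 * m)
  have hm0 : (0 : ℝ) < m := by exact_mod_cast hm1
  have hk0 : (m : ℝ) ^ 2 ≤ ((m ^ 2 + r : ℕ) : ℝ) := by
    push_cast
    linarith [Nat.cast_nonneg (α := ℝ) r]
  have hM : |M (m ^ 2 + r)| ≤ |M (m ^ 2)| + 2 * m * B := by
    have h1 := abs_sub_abs_le_abs_sub (M (m ^ 2 + r)) (M (m ^ 2))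
    have h2 := hinc (m ^ 2) r
    have h3 := mul_le_mul_of_nonneg_right hr hB0
    linarith
  rw [Real.norm_eq_abs, abs_div, Nat.abs_cast]
  calc |M (m ^ 2 + r)| / ((m ^ 2 + r : ℕ) : ℝ)
      ≤ (|M (m ^ 2)| + 2 * m * B) / (m : ℝ) ^ 2 := by gcongr
    _ = |M (m ^ 2) / (m : ℝ) ^ 2| + 2 * B * (m : ℝ)⁻¹ := by
      rw [abs_div, abs_of_pos (by positivity : (0 : ℝ) < (m : ℝ) ^ 2)]
      field_simp

namespace DoubleConvergence

section Walk

variable {c : ℕ} {G : SimpleGraph (Fin c)} [DecidableRel G.Adj] {π : Fin c → ℝ}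
  {Ω : Type*} [MeasurableSpace Ω] {P : Measure Ω} {x : ℕ → Ω → Fin c}

/-- The Markov property: conditionally on the walk up to time `m`, the next token is distributed
according to the transition probabilities from the current one. -/
theorem IsTokenProcess.markov (hx : IsTokenProcess G π P x) (m : ℕ) (p : Fin (m + 1) → Fin c)
    (z : Fin c) :
    P.real {ω | (fun i : Fin (m + 1) => x (c + i) ω) = p ∧ x (c + (m + 1)) ω = z} =
      P.real {ω | (fun i : Fin (m + 1) => x (c + i) ω) = p} * transition G (p (Fin.last m)) z := by
  let y : ℕ → Fin c := fun i => if h : i < m + 1 then p ⟨i, h⟩ else z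
  have h1 : {ω | (fun i : Fin (m + 1) => x (c + i) ω) = p} = {ω | ∀ i ≤ m, x (c + i) ω = y i} := by
    ext ω
    simp only [Set.mem_ofPred_eq, funext_iff, Fin.forall_iff]
    refine forall_congr' fun i => ?_
    constructor
    · intro h hi
      rw [h (Nat.lt_succ_of_le hi)]
      exact (dif_pos (Nat.lt_succ_of_le hi) : y i = _).symm
    · intro h hi
      rw [h (Nat.le_of_lt_succ hi)]
      exact dif_pos hi
  have h2 : {ω | (fun i : Fin (m + 1) => x (c + i) ω) = p ∧ x (c + (m + 1)) ω = z} =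
      {ω | ∀ i ≤ m + 1, x (c + i) ω = y i} := by
    ext ω
    have := Set.ext_iff.1 h1 ω
    simp only [Set.mem_ofPred_eq] at this ⊢
    rw [this]
    have hy : y (m + 1) = z := by simp [y]
    constructor
    · rintro ⟨ha, hb⟩ i hi
      rcases Nat.le_succ_iff.1 hi with h | rfl
      · exact ha i h
      · rw [hy, hb]
    · exact fun h => ⟨fun i hi => h i (hi.trans (Nat.le_succ m)), hy ▸ h (m + 1) le_rfl⟩
  rw [h1, h2, hx.walk, hx.walk, Finset.prod_range_succ, mul_assoc]
  congr 3
  · simp [y, Fin.last]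
  · simp [y]

/-- Martingale differences: `h` at the next token minus its conditional expectation is orthogonal
to every function of the past of the walk. -/
theorem IsTokenProcess.integral_mul_increment [IsProbabilityMeasure P]
    (hx : IsTokenProcess G π P x) (hT : ∀ y, ∑ z, transition G y z = 1) (h : Fin c → ℝ) (m : ℕ)
    (g : (Fin (m + 1) → Fin c) → ℝ) :
    ∫ ω, g (fun i => x (c + i) ω) *
      (h (x (c + (m + 1)) ω) - ∑ z, transition G (x (c + m) ω) z * h z) ∂P = 0 := by
  let X : Ω → (Fin (m + 1) → Fin c) × Fin c := fun ω => (fun i => x (c + i) ω, x (c + (m + 1)) ω)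
  have hX : Measurable X :=
    (measurable_pi_lambda _ fun i => hx.measurable _).prodMk (hx.measurable _)
  let φ : (Fin (m + 1) → Fin c) × Fin c → ℝ := fun p =>
    g p.1 * (h p.2 - ∑ z, transition G (p.1 (Fin.last m)) z * h z)
  have : IsProbabilityMeasure (P.map X) := Measure.isProbabilityMeasure_map hX.aemeasurable
  have h1 : ∫ ω, φ (X ω) ∂P = ∑ p, (P.map X).real {p} * φ p := by
    rw [← integral_map hX.aemeasurable (Measurable.of_discrete).aestronglyMeasurable,
      integral_fintype .of_finite]
    simp only [smul_eq_mul]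
  change ∫ ω, φ (X ω) ∂P = 0
  rw [h1, Fintype.sum_prod_type]
  refine Finset.sum_eq_zero fun p _ => ?_
  have h2 : ∀ z, (P.map X).real {(p, z)} =
      P.real {ω | (fun i : Fin (m + 1) => x (c + i) ω) = p} * transition G (p (Fin.last m)) z := by
    intro z
    rw [map_measureReal_apply hX (measurableSet_singleton _), ← hx.markov]
    congr 1
    ext ω
    simp [X, Prod.ext_iff]
  simp only [h2, φ]
  have h3 : ∀ z, P.real {ω | (fun i : Fin (m + 1) => x (c + i) ω) = p} *
      transition G (p (Fin.last m)) z *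
        (g p * (h z - ∑ w, transition G (p (Fin.last m)) w * h w)) =
      P.real {ω | (fun i : Fin (m + 1) => x (c + i) ω) = p} * g p *
        (transition G (p (Fin.last m)) z * h z -
          transition G (p (Fin.last m)) z * ∑ w, transition G (p (Fin.last m)) w * h w) :=
    fun z => by ring
  simp only [h3]
  rw [← Finset.mul_sum, Finset.sum_sub_distrib, ← Finset.sum_mul, hT, one_mul, sub_self, mul_zero]

/-- The martingale of `h` along the walk. -/
noncomputable def walkMartingale (G : SimpleGraph (Fin c)) [DecidableRel G.Adj] (x : ℕ → Ω → Fin c)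
    (h : Fin c → ℝ) (k : ℕ) (ω : Ω) : ℝ :=
  ∑ i ∈ Finset.range k, (h (x (c + (i + 1)) ω) - ∑ z, transition G (x (c + i) ω) z * h z)

theorem measurable_walkMartingale (hx : IsTokenProcess G π P x) (h : Fin c → ℝ) (k : ℕ) :
    Measurable (walkMartingale G x h k) := by
  unfold walkMartingale
  refine Finset.measurable_sum _ fun i _ => ?_
  exact ((Measurable.of_discrete (f := h)).comp (hx.measurable _)).sub
    ((Measurable.of_discrete (f := fun y => ∑ z, transition G y z * h z)).comp (hx.measurable _))

theorem exists_walk_increment_bound (G : SimpleGraph (Fin c)) [DecidableRel G.Adj]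
    (h : Fin c → ℝ) : ∃ B, ∀ y y', |h y' - ∑ z, transition G y z * h z| ≤ B := by
  refine ⟨∑ p : Fin c × Fin c, |h p.2 - ∑ z, transition G p.1 z * h z|, ?_⟩
  intro y y'
  exact Finset.single_le_sum
    (f := fun p : Fin c × Fin c => |h p.2 - ∑ z, transition G p.1 z * h z|)
    (fun p _ => abs_nonneg _) (Finset.mem_univ (y, y'))

/-- Orthogonality of the increments makes the second moment grow at most linearly. -/
theorem IsTokenProcess.integral_walkMartingale_sq_le [IsProbabilityMeasure P]
    (hx : IsTokenProcess G π P x) (hT : ∀ y, ∑ z, transition G y z = 1) {h : Fin c → ℝ} {B : ℝ}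
    (hB : ∀ y y', |h y' - ∑ z, transition G y z * h z| ≤ B) (k : ℕ) :
    Integrable (fun ω => walkMartingale G x h k ω ^ 2) P ∧
      ∫ ω, walkMartingale G x h k ω ^ 2 ∂P ≤ k * B ^ 2 := by
  have hbdd : ∀ k ω, |walkMartingale G x h k ω| ≤ k * B := by
    intro k ω
    refine (Finset.abs_sum_le_sum_abs _ _).trans
      ((Finset.sum_le_sum fun i _ => hB _ _).trans ?_)
    simp
  have hint : ∀ k, Integrable (fun ω => walkMartingale G x h k ω ^ 2) P := by
    intro k
    refine Integrable.of_bound ((measurable_walkMartingale hx h k).pow_const 2).aestronglyMeasurable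
      ((k * B) ^ 2) (Eventually.of_forall fun ω => ?_)
    rw [Real.norm_eq_abs, abs_pow]
    gcongr
    exact hbdd k ω
  refine ⟨hint k, ?_⟩
  induction k with
  | zero => simp [walkMartingale]
  | succ k ih =>
    set D : Ω → ℝ := fun ω =>
      h (x (c + (k + 1)) ω) - ∑ z, transition G (x (c + k) ω) z * h z with hD
    have hDm : Measurable D := ((Measurable.of_discrete (f := h)).comp (hx.measurable _)).sub
      ((Measurable.of_discrete (f := fun y => ∑ z, transition G y z * h z)).comp (hx.measurable _))
    have hDB : ∀ ω, |D ω| ≤ B := fun ω => hB _ _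
    have hD2 : Integrable (fun ω => D ω ^ 2) P := by
      refine Integrable.of_bound (hDm.pow_const 2).aestronglyMeasurable (B ^ 2)
        (Eventually.of_forall fun ω => ?_)
      rw [Real.norm_eq_abs, abs_pow]
      gcongr
      exact hDB ω
    have hMD : Integrable (fun ω => walkMartingale G x h k ω * D ω) P := by
      refine Integrable.of_bound
        ((measurable_walkMartingale hx h k).mul hDm).aestronglyMeasurable (k * B * B)
        (Eventually.of_forall fun ω => ?_)
      rw [Real.norm_eq_abs, abs_mul]
      exact mul_le_mul (hbdd k ω) (hDB ω) (abs_nonneg _) ((abs_nonneg _).trans (hbdd k ω))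
    have horth : ∫ ω, walkMartingale G x h k ω * D ω ∂P = 0 := by
      rw [← hx.integral_mul_increment hT h k fun p => ∑ i : Fin k,
        (h (p i.succ) - ∑ z, transition G (p i.castSucc) z * h z)]
      refine integral_congr_ae (Eventually.of_forall fun ω => ?_)
      simp only [walkMartingale, Finset.sum_range, hD, Fin.val_succ, Fin.val_castSucc]
    have hexp : ∀ ω, walkMartingale G x h (k + 1) ω ^ 2 =
        walkMartingale G x h k ω ^ 2 + 2 * (walkMartingale G x h k ω * D ω) + D ω ^ 2 := by
      intro ω
      simp only [walkMartingale, Finset.sum_range_succ, hD]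
      ring
    have hD2le : ∫ ω, D ω ^ 2 ∂P ≤ B ^ 2 := by
      have : ∫ ω, D ω ^ 2 ∂P ≤ ∫ _, B ^ 2 ∂P := by
        refine integral_mono hD2 (integrable_const _) fun ω => ?_
        exact sq_le_sq.2 ((hDB ω).trans (le_abs_self B))
      simpa using this
    simp only [hexp]
    have h1 := integral_add ((hint k).add (hMD.const_mul 2)) hD2
    simp only [Pi.add_apply] at h1
    rw [h1, integral_add (hint k) (hMD.const_mul 2), integral_const_mul, horth]
    push_cast
    linarith

theorem IsTokenProcess.ae_tendsto_walkMartingale [IsProbabilityMeasure P]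
    (hx : IsTokenProcess G π P x) (hT : ∀ y, ∑ z, transition G y z = 1) (h : Fin c → ℝ) :
    ∀ᵐ ω ∂P, Tendsto (fun k : ℕ => walkMartingale G x h k ω / k) atTop (𝓝 0) := by
  obtain ⟨B, hB⟩ := exists_walk_increment_bound G h
  have h1 := hx.integral_walkMartingale_sq_le hT hB
  have heq : ∀ (m : ℕ) ω, (walkMartingale G x h (m ^ 2) ω / (m : ℝ) ^ 2) ^ 2 =
      walkMartingale G x h (m ^ 2) ω ^ 2 * ((m : ℝ) ^ 4)⁻¹ := by
    intro m ω
    rw [div_pow, div_eq_mul_inv]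
    ring_nf
  have h2 : ∀ᵐ ω ∂P, Tendsto
      (fun m : ℕ => walkMartingale G x h (m ^ 2) ω / (m : ℝ) ^ 2) atTop (𝓝 0) := by
    refine ae_tendsto_zero_of_summable_integral_sq
      (fun m => (measurable_walkMartingale hx h _).div_const _) (fun m => ?_) ?_
    · simp only [heq]
      exact (h1 _).1.mul_const _
    · simp only [heq, integral_mul_const]
      refine Summable.of_nonneg_of_le (fun m => mul_nonneg
        (integral_nonneg fun ω => sq_nonneg _) (by positivity)) (fun m => ?_)
        ((Real.summable_nat_pow_inv.2 (by norm_num : 1 < 2)).mul_left (B ^ 2))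
      rcases Nat.eq_zero_or_pos m with rfl | hm
      · simp
      · have hm0 : (0 : ℝ) < m := by exact_mod_cast hm
        calc (∫ ω, walkMartingale G x h (m ^ 2) ω ^ 2 ∂P) * ((m : ℝ) ^ 4)⁻¹
            ≤ ((m ^ 2 : ℕ) * B ^ 2) * ((m : ℝ) ^ 4)⁻¹ := by
              gcongr
              exact (h1 _).2
          _ = B ^ 2 * ((m : ℝ) ^ 2)⁻¹ := by
              push_cast
              field_simp
  filter_upwards [h2] with ω hω
  refine tendsto_div_of_tendsto_sq (B := B) (fun k => ?_) hω
  simp only [walkMartingale, Finset.sum_range_succ, add_sub_cancel_left]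
  exact hB _ _

theorem freq_add (t : ℕ → Fin c) (m : ℕ) (y : Fin c) :
    (freq t (c + m) y : ℝ) = (((Finset.range c).filter fun j => t j = y).card : ℝ) +
      ∑ i ∈ Finset.range (m + 1), (if t (c + i) = y then 1 else 0) := by
  unfold freq
  rw [Finset.natCast_card_filter, Finset.natCast_card_filter, add_assoc,
    Finset.sum_range_add _ c (m + 1)]

/-- The ergodic theorem for the token process: the empirical frequencies tend to the stationary
distribution. -/
theorem IsTokenProcess.ae_tendsto_freq [IsProbabilityMeasure P]
    (hx : IsTokenProcess G π P x) (hπ : IsStationaryDist G π) (hG : G.Connected) (hc : 2 ≤ c)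
    (y : Fin c) :
    ∀ᵐ ω ∂P, Tendsto (fun k : ℕ => (freq (fun i => x i ω) k y : ℝ) / (k + 1)) atTop
      (𝓝 (π y)) := by
  obtain ⟨h, hh⟩ := hπ.exists_poisson hG hc y
  filter_upwards [hx.ae_tendsto_walkMartingale (sum_transition hG hc) h] with ω hω
  rw [← tendsto_add_atTop_iff_nat c]
  -- Beyond the martingale, the sum of the centered indicators telescopes.
  have hsum : ∀ k, ∑ i ∈ Finset.range k, ((if x (c + i) ω = y then (1 : ℝ) else 0) - π y) =
      walkMartingale G x h k ω + (h (x c ω) - h (x (c + k) ω)) := by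
    intro k
    induction k with
    | zero => simp [walkMartingale]
    | succ k ih =>
      simp only [walkMartingale, Finset.sum_range_succ] at ih ⊢
      rw [ih, ← hh]
      ring
  set a : ℝ := (((Finset.range c).filter fun j => x j ω = y).card : ℝ)
  obtain ⟨H, hH⟩ : ∃ H, ∀ y, |h y| ≤ H := ⟨∑ y, |h y|, fun y =>
    Finset.single_le_sum (f := fun y => |h y|) (fun _ _ => abs_nonneg _) (Finset.mem_univ y)⟩
  have hdecomp : ∀ m : ℕ, (freq (fun i => x i ω) (m + c) y : ℝ) / ((m + c : ℕ) + 1) = π y +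
      (walkMartingale G x h (m + 1) ω / ((m + 1 : ℕ) : ℝ) * (((m : ℝ) + 1) / (m + c + 1)) +
      (a + (h (x c ω) - h (x (c + (m + 1)) ω)) - c * π y) / (m + c + 1)) := by
    intro m
    have h1 := freq_add (fun i => x i ω) m y
    have h2 := hsum (m + 1)
    rw [Finset.sum_sub_distrib, Finset.sum_const, Finset.card_range, nsmul_eq_mul] at h2
    rw [add_comm m c, h1, eq_add_of_sub_eq h2]
    have h3 : (m : ℝ) + 1 ≠ 0 := by positivity
    have h4 : (m : ℝ) + c + 1 ≠ 0 := by positivity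
    have h5 : (c : ℝ) + m + 1 ≠ 0 := by positivity
    push_cast
    field_simp
    ring
  simp only [hdecomp]
  have hden : Tendsto (fun m : ℕ => (m : ℝ) + c + 1) atTop atTop :=
    tendsto_atTop_add_const_right _ _
      (tendsto_atTop_add_const_right _ _ tendsto_natCast_atTop_atTop)
  have h1 : Tendsto (fun m : ℕ => walkMartingale G x h (m + 1) ω / ((m + 1 : ℕ) : ℝ) *
      (((m : ℝ) + 1) / (m + c + 1))) atTop (𝓝 0) := by
    refine squeeze_zero_norm (fun m => ?_)
      (tendsto_zero_iff_norm_tendsto_zero.1 ((tendsto_add_atTop_iff_nat 1).2 hω))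
    rw [norm_mul]
    refine mul_le_of_le_one_right (norm_nonneg _) ?_
    rw [Real.norm_of_nonneg (by positivity), div_le_one (by positivity)]
    linarith [Nat.cast_nonneg (α := ℝ) c]
  have h2 : Tendsto (fun m : ℕ => (a + (h (x c ω) - h (x (c + (m + 1)) ω)) - c * π y) /
      ((m : ℝ) + c + 1)) atTop (𝓝 0) := by
    refine squeeze_zero_norm (fun m => ?_) (hden.const_div_atTop (|a| + (H + H) + |c * π y|))
    rw [norm_div, Real.norm_of_nonneg (by positivity : (0 : ℝ) ≤ m + c + 1), Real.norm_eq_abs]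
    gcongr
    have h3 := abs_sub (a + (h (x c ω) - h (x (c + (m + 1)) ω))) (c * π y)
    have h4 := abs_add_le a (h (x c ω) - h (x (c + (m + 1)) ω))
    have h5 := abs_sub (h (x c ω)) (h (x (c + (m + 1)) ω))
    linarith [hH (x c ω), hH (x (c + (m + 1)) ω)]
  simpa using (h1.add h2).const_add (π y)

end Walk

end DoubleConvergence

/-! ### Limits of token representations -/

namespace DoubleConvergence

/-- The vectors `v n k`, `k < n`, are asymptotically determined by the token `t k`: they are bounded
uniformly in `n > N`, and as `k → ∞` the distance of `v n k` to `u (t k)` tends to zero, uniformly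
in `n > N`. -/
structure TokenLimit {c : ℕ} {E : Type*} [NormedAddCommGroup E] (N : ℕ) (t : ℕ → Fin c)
    (v : ∀ n, Fin n → E) (u : Fin c → E) : Prop where
  bounded : ∃ C, ∀ n, N < n → ∀ k, ‖v n k‖ ≤ C
  tendsto : ∀ ε > 0, ∀ᶠ k in atTop, ∀ n, N < n → ∀ h : k < n, ‖v n ⟨k, h⟩ - u (t k)‖ < ε

section Basic

variable {c : ℕ} {E : Type*} [NormedAddCommGroup E] {N : ℕ} {t : ℕ → Fin c}
  {v v' : ∀ n, Fin n → E} {u u' : Fin c → E}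

theorem TokenLimit.of_eq (h : ∀ n, N < n → ∀ k, v n k = u (t k)) : TokenLimit N t v u where
  bounded := by
    refine ⟨∑ y, ‖u y‖, fun n hn k => ?_⟩
    rw [h n hn k]
    exact Finset.single_le_sum (f := fun y => ‖u y‖) (fun _ _ => norm_nonneg _) (Finset.mem_univ _)
  tendsto := by
    intro ε hε
    refine Eventually.of_forall fun k n hn hk => ?_
    rw [h n hn, sub_self, norm_zero]
    exact hε

theorem TokenLimit.congr (hv : TokenLimit N t v u) (h : ∀ n, N < n → ∀ k, v' n k = v n k) :
    TokenLimit N t v' u where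
  bounded := by
    obtain ⟨C, hC⟩ := hv.bounded
    exact ⟨C, fun n hn k => by rw [h n hn]; exact hC n hn k⟩
  tendsto := by
    intro ε hε
    filter_upwards [hv.tendsto ε hε] with k hk n hn hkn
    rw [h n hn]
    exact hk n hn hkn

theorem TokenLimit.add (hv : TokenLimit N t v u) (hv' : TokenLimit N t v' u') :
    TokenLimit N t (fun n k => v n k + v' n k) (fun y => u y + u' y) where
  bounded := by
    obtain ⟨C, hC⟩ := hv.bounded
    obtain ⟨C', hC'⟩ := hv'.bounded
    exact ⟨C + C', fun n hn k => (norm_add_le _ _).trans (add_le_add (hC n hn k) (hC' n hn k))⟩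
  tendsto := by
    intro ε hε
    filter_upwards [hv.tendsto (ε / 2) (half_pos hε), hv'.tendsto (ε / 2) (half_pos hε)]
      with k hk hk' n hn hkn
    rw [add_sub_add_comm]
    linarith [norm_add_le (v n ⟨k, hkn⟩ - u (t k)) (v' n ⟨k, hkn⟩ - u' (t k)), hk n hn hkn,
      hk' n hn hkn]

theorem TokenLimit.comp_lipschitz {F : Type*} [NormedAddCommGroup F] (hv : TokenLimit N t v u)
    {σ : E → F} {K : NNReal} (hσ : LipschitzWith K σ) :
    TokenLimit N t (fun n k => σ (v n k)) (fun y => σ (u y)) where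
  bounded := by
    obtain ⟨C, hC⟩ := hv.bounded
    refine ⟨K * C + ‖σ 0‖, fun n hn k => ?_⟩
    have h1 := hσ.norm_sub_le (v n k) 0
    have h2 := norm_sub_norm_le (σ (v n k)) (σ 0)
    rw [sub_zero] at h1
    have h3 := mul_le_mul_of_nonneg_left (hC n hn k) K.2
    change (K : ℝ) * _ ≤ K * C at h3
    linarith
  tendsto := by
    intro ε hε
    have hK : (0 : ℝ) < K + 1 := add_pos_of_nonneg_of_pos K.2 one_pos
    filter_upwards [hv.tendsto (ε / (K + 1)) (div_pos hε hK)] with k hk n hn hkn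
    have h1 := hσ.norm_sub_le (v n ⟨k, hkn⟩) (u (t k))
    have h2 := (lt_div_iff₀ hK).1 (hk n hn hkn)
    nlinarith [norm_nonneg (v n ⟨k, hkn⟩ - u (t k))]

theorem TokenLimit.const_smul [NormedSpace ℝ E] (hv : TokenLimit N t v u) (r : ℝ) :
    TokenLimit N t (fun n k => r • v n k) (fun y => r • u y) :=
  hv.comp_lipschitz (σ := fun z => r • z) (lipschitzWith_smul r)

/-- The columns at the last occurrences converge to the token limit, provided that every token
occurs infinitely often. -/
theorem TokenLimit.tendsto_lastOcc {d : ℕ} {v : ∀ n, Fin n → EuclideanSpace ℝ (Fin d)}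
    {u : Fin c → EuclideanSpace ℝ (Fin d)} (hv : TokenLimit N t v u)
    (ht : ∀ y, ∃ᶠ k in atTop, t k = y) :
    Tendsto (fun n => lastOcc t (v n)) atTop (𝓝 (mat u)) := by
  refine tendsto_pi_nhds.2 fun i => tendsto_pi_nhds.2 fun y => ?_
  rw [Metric.tendsto_atTop]
  intro ε hε
  obtain ⟨K, hK⟩ := eventually_atTop.1 (hv.tendsto ε hε)
  obtain ⟨k, hkK, hky⟩ := frequently_atTop.1 (ht y) K
  refine ⟨max k N + 1, fun n hn => ?_⟩
  have hkn : k < n := by omega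
  have hNn : N < n := by omega
  have hmem : (⟨k, hkn⟩ : Fin n) ∈ Finset.univ.filter fun k : Fin n => t k = y := by simp [hky]
  have hne : (Finset.univ.filter fun k : Fin n => t k = y).Nonempty := ⟨_, hmem⟩
  set m := (Finset.univ.filter fun k : Fin n => t k = y).max' hne with hm
  have hty : t m = y := (Finset.mem_filter.1 (Finset.max'_mem _ hne)).2
  have hkm : k ≤ m := Fin.le_def.1 (Finset.le_max' _ _ hmem)
  have h1 := hK m (hkK.trans hkm) n hNn m.2
  rw [hty] at h1
  have h2 : lastOcc t (v n) i y = v n m i := by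
    simp only [lastOcc, mat, Matrix.of_apply, dif_pos hne, hm]
  rw [h2, dist_eq_norm]
  exact (PiLp.norm_apply_le (v n m - u y) i).trans_lt h1

end Basic

section Attention

variable {c : ℕ} {E : Type*} [NormedAddCommGroup E] [NormedSpace ℝ E] {N : ℕ} {t : ℕ → Fin c}
  {v : ∀ n, Fin n → E} {u : Fin c → E} {π : Fin c → ℝ}

theorem IsAttentionMap.sum_Iic {n : ℕ} {A : Matrix (Fin n) (Fin n) ℝ} (hA : IsAttentionMap A)
    (k : Fin n) : ∑ j ∈ Finset.Iic k, A k j = 1 := by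
  rw [← hA.row_sum k]
  refine Finset.sum_subset (Finset.subset_univ _) fun j _ hj => hA.lower k j ?_
  simpa using hj

theorem IsAttentionMap.norm_sum_smul_le {n : ℕ} {A : Matrix (Fin n) (Fin n) ℝ}
    (hA : IsAttentionMap A) {w : Fin n → E} {C : ℝ} (hw : ∀ k, ‖w k‖ ≤ C) (k : Fin n) :
    ‖∑ j ∈ Finset.Iic k, A k j • w j‖ ≤ C := by
  calc ‖∑ j ∈ Finset.Iic k, A k j • w j‖ ≤ ∑ j ∈ Finset.Iic k, A k j * C := by
        refine norm_sum_le_of_le _ fun j _ => ?_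
        rw [norm_smul, Real.norm_of_nonneg (hA.nonneg k j)]
        exact mul_le_mul_of_nonneg_left (hw j) (hA.nonneg k j)
    _ = C := by rw [← Finset.sum_mul, hA.sum_Iic, one_mul]

/-- A nice attention map gives little weight to the early positions, so it averages errors that are
small from position `K` on to a small error. -/
theorem IsNiceAttention.norm_sum_smul_le {n : ℕ} {A : Matrix (Fin n) (Fin n) ℝ} {ψ : ℝ}
    (hA : IsNiceAttention A ψ) {w : Fin n → E} {C η : ℝ} {K : ℕ} (hC : ∀ j, ‖w j‖ ≤ C)
    (hη : 0 ≤ η) (hK : ∀ j : Fin n, K ≤ (j : ℕ) → ‖w j‖ ≤ η) (k : Fin n) (hKk : K ≤ (k : ℕ)) :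
    ‖∑ j ∈ Finset.Iic k, A k j • w j‖ ≤ η + C * (ψ * K / ((k : ℕ) + 1)) := by
  have hC0 : 0 ≤ C := (norm_nonneg _).trans (hC k)
  have hearly : ∑ j ∈ (Finset.Iic k).filter (fun j : Fin n => (j : ℕ) < K), A k j ≤
      ψ * K / ((k : ℕ) + 1) := by
    rcases Nat.eq_zero_or_pos K with rfl | hK0
    · simp
    · let j₀ : Fin n := ⟨K - 1, by omega⟩
      have h1 := hA.nice k j₀ (Fin.le_def.2 (by simp only [j₀]; omega))
      have h2 : ((j₀ : ℕ) : ℝ) + 1 = K := by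
        simp only [j₀]
        exact_mod_cast Nat.sub_add_cancel hK0
      rw [h2] at h1
      refine (Finset.sum_le_sum_of_subset_of_nonneg (fun j hj => ?_)
        fun j _ _ => hA.nonneg k j).trans h1
      rw [Finset.mem_Iic, Fin.le_def]
      have := (Finset.mem_filter.1 hj).2
      simp only [j₀]
      omega
  calc ‖∑ j ∈ Finset.Iic k, A k j • w j‖
      ≤ ∑ j ∈ Finset.Iic k, (A k j * η + C * if (j : ℕ) < K then A k j else 0) := by
        refine norm_sum_le_of_le _ fun j _ => ?_
        have hn := hA.nonneg k j
        rw [norm_smul, Real.norm_of_nonneg hn]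
        split_ifs with h
        · nlinarith [hC j, mul_nonneg hn hη]
        · nlinarith [hK j (not_lt.1 h)]
    _ = η + C * ∑ j ∈ (Finset.Iic k).filter (fun j : Fin n => (j : ℕ) < K), A k j := by
        rw [Finset.sum_add_distrib, ← Finset.sum_mul, hA.toIsAttentionMap.sum_Iic, one_mul,
          ← Finset.mul_sum, Finset.sum_filter]
    _ ≤ _ := by gcongr

theorem tendsto_freq_ratio
    (hfreq : ∀ y, Tendsto (fun k : ℕ => (freq t k y : ℝ) / (k + 1)) atTop (𝓝 (π y)))
    {s : Finset (Fin c)} (hs : ∑ z ∈ s, π z ≠ 0) (y : Fin c) :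
    Tendsto (fun k : ℕ => (freq t k y : ℝ) / ∑ z ∈ s, (freq t k z : ℝ)) atTop
      (𝓝 (π y / ∑ z ∈ s, π z)) := by
  refine ((hfreq y).div (tendsto_finsetSum s fun z _ => hfreq z) hs).congr fun k => ?_
  rw [Pi.div_apply, ← Finset.sum_div, div_div_div_cancel_right₀ (by positivity)]

/-- An attention map that reflects `f` acts on token limits as the average with respect to the
stationary distribution conditioned on `f`. -/
theorem TokenLimit.reflects (hv : TokenLimit N t v u)
    (hfreq : ∀ y, Tendsto (fun k : ℕ => (freq t k y : ℝ) / (k + 1)) atTop (𝓝 (π y)))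
    {f : Fin c → Finset (Fin c)} (hf : ∀ y, ∑ z ∈ f y, π z ≠ 0)
    {A : ∀ n, Matrix (Fin n) (Fin n) ℝ} {ψ : ℝ} (hA : ∀ n, N < n → Reflects t (A n) ψ f) :
    TokenLimit N t (fun n k => ∑ j ∈ Finset.Iic k, A n k j • v n j)
      (fun y => ∑ z ∈ f y, (π z / ∑ z' ∈ f y, π z') • u z) where
  bounded := by
    obtain ⟨C, hC⟩ := hv.bounded
    exact ⟨C, fun n hn k => (hA n hn).toIsAttentionMap.norm_sum_smul_le (hC n hn) k⟩
  tendsto := by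
    intro ε hε
    obtain ⟨C, hC⟩ := hv.bounded
    set U : ℝ := ∑ y, ‖u y‖ with hU
    have huU : ∀ y, ‖u y‖ ≤ U := fun y =>
      Finset.single_le_sum (f := fun y => ‖u y‖) (fun _ _ => norm_nonneg _) (Finset.mem_univ y)
    obtain ⟨K, hK⟩ := eventually_atTop.1 (hv.tendsto (ε / 2) (half_pos hε))
    -- The error of the conditioned empirical frequencies, summed over all pairs of tokens.
    set e : ℕ → ℝ := fun k => ∑ y, ∑ z, (ψ / √((k : ℕ) + 1) +
      |(freq t k z : ℝ) / ∑ z' ∈ f y, (freq t k z' : ℝ) - π z / ∑ z' ∈ f y, π z'|) * ‖u z‖ with he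
    have hψ : Tendsto (fun k : ℕ => ψ / √((k : ℝ) + 1)) atTop (𝓝 0) :=
      (Real.tendsto_sqrt_atTop.comp
        (tendsto_atTop_add_const_right _ 1 tendsto_natCast_atTop_atTop)).const_div_atTop ψ
    have he0 : Tendsto e atTop (𝓝 0) := by
      have : (0 : ℝ) = ∑ y : Fin c, ∑ z : Fin c,
          (0 + |π z / ∑ z' ∈ f y, π z' - π z / ∑ z' ∈ f y, π z'|) * ‖u z‖ := by simp
      rw [this]
      exact tendsto_finsetSum _ fun y _ => tendsto_finsetSum _ fun z _ =>
        (hψ.add ((tendsto_freq_ratio hfreq (hf y) z).sub_const _).abs).mul_const _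
    have hearly : Tendsto (fun k : ℕ => (C + U) * (ψ * K / ((k : ℝ) + 1))) atTop (𝓝 0) := by
      have := ((tendsto_atTop_add_const_right atTop (1 : ℝ)
        (tendsto_natCast_atTop_atTop (R := ℝ))).const_div_atTop (ψ * K)).const_mul (C + U)
      rwa [mul_zero] at this
    have hsum := hearly.add he0
    rw [add_zero] at hsum
    filter_upwards [eventually_ge_atTop K, eventually_ge_atTop c,
      hsum.eventually_lt_const (half_pos hε)] with k hkK hkc hkε n hn hkn
    have hR := hA n hn
    set k' : Fin n := ⟨k, hkn⟩ with hk'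
    have h1 : ‖∑ j ∈ Finset.Iic k', A n k' j • (v n j - u (t j))‖ ≤
        ε / 2 + (C + U) * (ψ * K / ((k : ℝ) + 1)) := by
      refine hR.toIsNiceAttention.norm_sum_smul_le (fun j => ?_) (half_pos hε).le
        (fun j hj => (hK j hj n hn j.2).le) k' hkK
      exact (norm_sub_le _ _).trans (add_le_add (hC n hn j) (huU _))
    have h2 : ∑ j ∈ Finset.Iic k', A n k' j • u (t j) =
        ∑ z ∈ f (t k), (∑ j ∈ Finset.Iic k', A n k' j * (if t j = z then 1 else 0)) • u z := by
      simp only [Finset.sum_smul]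
      rw [Finset.sum_comm]
      refine Finset.sum_congr rfl fun j hj => ?_
      simp only [mul_ite, mul_one, mul_zero, ite_smul, zero_smul, Finset.sum_ite_eq]
      split_ifs with hmem
      · rfl
      · -- Outside the support of the map the weight vanishes.
        have : A n k' j = 0 := by
          by_contra hne
          exact hmem (hR.support k' j hkc (Finset.mem_Iic.1 hj)
            (lt_of_le_of_ne (hR.nonneg k' j) (Ne.symm hne)))
        rw [this, zero_smul]
    have h3 : ‖∑ j ∈ Finset.Iic k', A n k' j • u (t j) -
        ∑ z ∈ f (t k), (π z / ∑ z' ∈ f (t k), π z') • u z‖ ≤ e k := by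
      rw [h2, ← Finset.sum_sub_distrib]
      simp only [← sub_smul]
      have hψ0 : 0 ≤ ψ / √((k : ℝ) + 1) := div_nonneg hR.pos.le (Real.sqrt_nonneg _)
      have hterm : ∀ y z, 0 ≤ (ψ / √((k : ℝ) + 1) + |(freq t k z : ℝ) /
          ∑ z' ∈ f y, (freq t k z' : ℝ) - π z / ∑ z' ∈ f y, π z'|) * ‖u z‖ := fun y z => by
        positivity
      refine (norm_sum_le_of_le (f (t k)) (fun z hz => ?_)).trans
        ((Finset.sum_le_sum_of_subset_of_nonneg (Finset.subset_univ (f (t k)))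
          fun z _ _ => hterm (t k) z).trans
        (Finset.single_le_sum (f := fun y => ∑ z, (ψ / √((k : ℝ) + 1) + |(freq t k z : ℝ) /
          ∑ z' ∈ f y, (freq t k z' : ℝ) - π z / ∑ z' ∈ f y, π z'|) * ‖u z‖)
          (fun y _ => Finset.sum_nonneg fun z _ => hterm y z) (Finset.mem_univ (t k))))
      rw [norm_smul]
      refine mul_le_mul_of_nonneg_right ?_ (norm_nonneg _)
      rw [Real.norm_eq_abs]
      exact (abs_sub_le _ _ _).trans (add_le_add_left (hR.balanced k' z hz) _)
    have h4 : ∑ j ∈ Finset.Iic k', A n k' j • v n j -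
        ∑ z ∈ f (t k), (π z / ∑ z' ∈ f (t k), π z') • u z =
        ∑ j ∈ Finset.Iic k', A n k' j • (v n j - u (t j)) +
        (∑ j ∈ Finset.Iic k', A n k' j • u (t j) -
          ∑ z ∈ f (t k), (π z / ∑ z' ∈ f (t k), π z') • u z) := by
      simp only [smul_sub, Finset.sum_sub_distrib]
      abel
    rw [h4]
    linarith [norm_add_le (∑ j ∈ Finset.Iic k', A n k' j • (v n j - u (t j)))
      (∑ j ∈ Finset.Iic k', A n k' j • u (t j) -
        ∑ z ∈ f (t k), (π z / ∑ z' ∈ f (t k), π z') • u z)]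

end Attention

section Model

variable {c : ℕ} {G : SimpleGraph (Fin c)} [DecidableRel G.Adj] {π : Fin c → ℝ}
  {N : ℕ} {t : ℕ → Fin c}

theorem sum_sinkAttention_smul {E : Type*} [AddCommGroup E] [Module ℝ E] {n : ℕ} (hn : 0 < n)
    (w : Fin n → E) (k : Fin n) :
    ∑ j ∈ Finset.Iic k, sinkAttention n k j • w j = w ⟨0, hn⟩ := by
  rw [Finset.sum_eq_single (⟨0, hn⟩ : Fin n)]
  · simp [sinkAttention]
  · intro j _ hj
    have : (j : ℕ) ≠ 0 := fun h => hj (Fin.ext h)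
    simp [sinkAttention, this]
  · intro h
    exact absurd (Finset.mem_Iic.2 (Fin.le_def.2 (Nat.zero_le _))) h

theorem IsAttentionMap.apply_zero_zero {n : ℕ} {A : Matrix (Fin n) (Fin n) ℝ}
    (hA : IsAttentionMap A) (hn : 0 < n) : A ⟨0, hn⟩ ⟨0, hn⟩ = 1 := by
  rw [← hA.row_sum ⟨0, hn⟩, Finset.sum_eq_single]
  · intro j _ hj
    exact hA.lower _ _ (Fin.lt_def.2 (Nat.pos_of_ne_zero fun h => hj (Fin.ext h)))
  · simp

theorem IsMixedAttention.apply_zero_zero {n : ℕ} {A : Matrix (Fin n) (Fin n) ℝ}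
    {ρA ρB ρO ρT ψA ψB ψO : ℝ} (hA : IsMixedAttention G t ρA ρB ρO ρT ψA ψB ψO A)
    (hρ : ρA + ρB + ρO + ρT = 1) (hn : 0 < n) : A ⟨0, hn⟩ ⟨0, hn⟩ = 1 := by
  obtain ⟨AA, AB, AO, hAA, hAB, hAO, rfl⟩ := hA
  simp [hAA.toIsAttentionMap.apply_zero_zero hn, hAB.toIsAttentionMap.apply_zero_zero hn,
    hAO.toIsAttentionMap.apply_zero_zero hn, sinkAttention, hρ]

/-- The hidden representations of the first position, layer by layer. That position attends only to
itself, so they depend neither on the attention maps nor on the number of positions. -/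
def sinkRep {d : ℕ} (b₀ : EuclideanSpace ℝ (Fin d))
    (σ : ℕ → EuclideanSpace ℝ (Fin d) → EuclideanSpace ℝ (Fin d)) :
    ℕ → EuclideanSpace ℝ (Fin d)
  | 0 => b₀
  | ℓ + 1 => σ ℓ (sinkRep b₀ σ ℓ)

/-- The limit, as the position tends to infinity, of the input of the map `σ`: the mixture of the
token itself, the average over its neighbors, the average over all tokens, and the sink. -/
noncomputable def limitInput {d : ℕ} (G : SimpleGraph (Fin c)) [DecidableRel G.Adj]
    (π : Fin c → ℝ) (ρA ρB ρO ρT : ℝ) (s : EuclideanSpace ℝ (Fin d))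
    (u : Fin c → EuclideanSpace ℝ (Fin d)) (y : Fin c) : EuclideanSpace ℝ (Fin d) :=
  ρA • u y + ρB • ∑ z ∈ G.neighborFinset y, (π z / ∑ z' ∈ G.neighborFinset y, π z') • u z +
    ρO • ∑ z, (π z / ∑ z', π z') • u z + ρT • s

/-- The limits of the hidden representations, layer by layer. -/
noncomputable def limitRep {d : ℕ} (G : SimpleGraph (Fin c)) [DecidableRel G.Adj] (π : Fin c → ℝ)
    (ρA ρB ρO ρT : ℕ → ℝ) (b : Fin c → EuclideanSpace ℝ (Fin d)) (b₀ : EuclideanSpace ℝ (Fin d))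
    (σ : ℕ → EuclideanSpace ℝ (Fin d) → EuclideanSpace ℝ (Fin d)) :
    ℕ → Fin c → EuclideanSpace ℝ (Fin d)
  | 0, y => b y
  | ℓ + 1, y => σ ℓ (limitInput G π (ρA ℓ) (ρB ℓ) (ρO ℓ) (ρT ℓ) (sinkRep b₀ σ ℓ)
      (limitRep G π ρA ρB ρO ρT b b₀ σ ℓ) y)

/-- A mixed attention map transforms token limits by `limitInput`. -/
theorem TokenLimit.mixed {d : ℕ} {v : ∀ n, Fin n → EuclideanSpace ℝ (Fin d)}
    {u : Fin c → EuclideanSpace ℝ (Fin d)} (hv : TokenLimit N t v u)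
    {s : EuclideanSpace ℝ (Fin d)} (hs : ∀ n, N < n → ∀ hn : 0 < n, v n ⟨0, hn⟩ = s)
    (hfreq : ∀ y, Tendsto (fun k : ℕ => (freq t k y : ℝ) / (k + 1)) atTop (𝓝 (π y)))
    (hπ : ∀ y, 0 < π y) (hadj : ∀ y, ∃ z, G.Adj y z) {ρA ρB ρO ρT ψA ψB ψO : ℝ}
    {A : ∀ n, Matrix (Fin n) (Fin n) ℝ}
    (hA : ∀ n, N < n → IsMixedAttention G t ρA ρB ρO ρT ψA ψB ψO (A n)) :
    TokenLimit N t (fun n k => ∑ j ∈ Finset.Iic k, A n k j • v n j)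
      (limitInput G π ρA ρB ρO ρT s u) := by
  have hex : ∀ n, ∃ AA AB AO : Matrix (Fin n) (Fin n) ℝ, N < n →
      (Reflects t AA ψA (fun y => {y}) ∧ Reflects t AB ψB (fun y => G.neighborFinset y) ∧
        Reflects t AO ψO (fun _ => Finset.univ) ∧
        A n = ρA • AA + ρB • AB + ρO • AO + ρT • sinkAttention n) := by
    intro n
    by_cases hn : N < n
    · obtain ⟨AA, AB, AO, h⟩ := hA n hn
      exact ⟨AA, AB, AO, fun _ => h⟩
    · exact ⟨0, 0, 0, fun h => absurd h hn⟩
  choose AA AB AO h using hex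
  have hpos : ∀ (S : Finset (Fin c)), S.Nonempty → ∑ z ∈ S, π z ≠ 0 :=
    fun S hS => (Finset.sum_pos (fun z _ => hπ z) hS).ne'
  have hself := hv.reflects hfreq (f := fun y => {y})
    (fun y => hpos _ (Finset.singleton_nonempty y)) (fun n hn => (h n hn).1)
  have hnbr := hv.reflects hfreq (f := fun y => G.neighborFinset y)
    (fun y => hpos _ ((hadj y).imp fun z hz => (G.mem_neighborFinset y z).2 hz))
    (fun n hn => (h n hn).2.1)
  have hall := hv.reflects hfreq (f := fun _ => Finset.univ)
    (fun y => hpos _ ⟨y, Finset.mem_univ y⟩) (fun n hn => (h n hn).2.2.1)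
  have hself' : (fun y => ∑ z ∈ ({y} : Finset (Fin c)),
      (π z / ∑ z' ∈ ({y} : Finset (Fin c)), π z') • u z) = u := by
    ext1 y
    rw [Finset.sum_singleton, Finset.sum_singleton, div_self (hπ y).ne', one_smul]
  rw [hself'] at hself
  have hsink : TokenLimit N t (fun n k => ∑ j ∈ Finset.Iic k, sinkAttention n k j • v n j)
      (fun _ => s) := by
    refine TokenLimit.of_eq fun n hn k => ?_
    rw [sum_sinkAttention_smul (Nat.zero_lt_of_lt hn), hs n hn]
  refine ((((hself.const_smul ρA).add (hnbr.const_smul ρB)).add (hall.const_smul ρO)).add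
    (hsink.const_smul ρT)).congr fun n hn k => ?_
  rw [(h n hn).2.2.2]
  simp only [Finset.smul_sum, ← Finset.sum_add_distrib, Matrix.add_apply, Matrix.smul_apply,
    add_smul, smul_assoc]

/-- In every layer the hidden representations have a token limit, given by `limitRep`. -/
theorem tokenLimit_hiddenRep {d : ℕ}
    (hfreq : ∀ y, Tendsto (fun k : ℕ => (freq t k y : ℝ) / (k + 1)) atTop (𝓝 (π y)))
    (hπ : ∀ y, 0 < π y) (hadj : ∀ y, ∃ z, G.Adj y z) {ρA ρB ρO ρT ψA ψB ψO : ℕ → ℝ}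
    (hρ : ∀ ℓ, ρA ℓ + ρB ℓ + ρO ℓ + ρT ℓ = 1) {A : (n : ℕ) → ℕ → Matrix (Fin n) (Fin n) ℝ}
    (hA : ∀ n ℓ, N < n →
      IsMixedAttention G t (ρA ℓ) (ρB ℓ) (ρO ℓ) (ρT ℓ) (ψA ℓ) (ψB ℓ) (ψO ℓ) (A n ℓ))
    (b : Fin c → EuclideanSpace ℝ (Fin d))
    {σ : ℕ → EuclideanSpace ℝ (Fin d) → EuclideanSpace ℝ (Fin d)}
    (hσ : ∀ ℓ, ∃ K, LipschitzWith K (σ ℓ)) (ℓ : ℕ) :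
    TokenLimit N t (fun n => hiddenRep t b (A n) σ ℓ)
      (limitRep G π ρA ρB ρO ρT b (b (t 0)) σ ℓ) := by
  have hsink : ∀ ℓ n, N < n → ∀ hn : 0 < n,
      hiddenRep t b (A n) σ ℓ ⟨0, hn⟩ = sinkRep (b (t 0)) σ ℓ := by
    intro ℓ n hNn hn
    induction ℓ with
    | zero => rfl
    | succ ℓ ih =>
      have hIic : Finset.Iic (⟨0, hn⟩ : Fin n) = {⟨0, hn⟩} := by
        ext j
        simp [Fin.le_def, Fin.ext_iff]
      simp only [hiddenRep, sinkRep]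
      rw [hIic, Finset.sum_singleton, (hA n ℓ hNn).apply_zero_zero (hρ ℓ) hn, one_smul, ih]
  induction ℓ with
  | zero => exact TokenLimit.of_eq fun n _ k => rfl
  | succ ℓ ih =>
    obtain ⟨K, hK⟩ := hσ ℓ
    exact (ih.mixed (hsink ℓ) hfreq hπ hadj fun n hn => hA n ℓ hn).comp_lipschitz hK

theorem frequently_eq_of_tendsto_freq {y : Fin c}
    (hfreq : Tendsto (fun k : ℕ => (freq t k y : ℝ) / (k + 1)) atTop (𝓝 (π y)))
    (hπ : 0 < π y) : ∃ᶠ k in atTop, t k = y := by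
  intro hnot
  obtain ⟨K, hK⟩ := eventually_atTop.1 hnot
  have hle : ∀ k, freq t k y ≤ K := by
    intro k
    rw [freq, ← Finset.card_range K]
    refine Finset.card_le_card fun j hj => Finset.mem_range.2 ?_
    by_contra hj'
    exact hK j (not_lt.1 hj') (Finset.mem_filter.1 hj).2
  have hzero : Tendsto (fun k : ℕ => (freq t k y : ℝ) / (k + 1)) atTop (𝓝 0) := by
    refine squeeze_zero (fun k => by positivity) (fun k => ?_)
      ((tendsto_atTop_add_const_right atTop (1 : ℝ)
        (tendsto_natCast_atTop_atTop (R := ℝ))).const_div_atTop (K : ℝ))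
    gcongr
    exact hle k
  exact hπ.ne' (tendsto_nhds_unique hfreq hzero)

end Model

end DoubleConvergence

/-! ### Ordered absolute eigenvalues -/

namespace DoubleConvergence

section Eigenvalues

variable {c : ℕ}

theorem absEigenvalue_nonneg (S : Matrix (Fin c) (Fin c) ℝ) (k : ℕ) : 0 ≤ absEigenvalue S k := by
  unfold absEigenvalue
  rcases lt_or_ge (k - 1) ((S.charpoly.roots.map fun t : ℝ => |t|).sort (· ≥ ·)).length
    with hlt | hge
  · rw [List.getD_eq_getElem _ _ hlt]
    obtain ⟨t, _, ht⟩ := Multiset.mem_map.1 ((Multiset.mem_sort _).1 (List.getElem_mem hlt))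
    exact ht ▸ abs_nonneg t
  · rw [List.getD_eq_default _ _ hge]

theorem roots_charpoly_of_orthogonal_conj {S Q : Matrix (Fin c) (Fin c) ℝ} {μ : Fin c → ℝ}
    (hQ : Q.transpose * Q = 1) (hS : S = Q * Matrix.diagonal μ * Q.transpose) :
    S.charpoly.roots = Finset.univ.val.map μ := by
  rw [hS, Matrix.charpoly_mul_comm, ← mul_assoc, hQ, one_mul, Matrix.charpoly_diagonal]
  have h := Polynomial.roots_multiset_prod_X_sub_C (Finset.univ.val.map μ)
  rwa [Multiset.map_map] at h

/-- If the absolute values of the first `q` eigenvalues dominate those of the others, then the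
ordered list of absolute eigenvalues is the ordered list of the first `q` followed by the ordered
list of the others. -/
theorem absEigenvalue_of_leading {S Q : Matrix (Fin c) (Fin c) ℝ} {μ : Fin c → ℝ}
    (hQ : Q.transpose * Q = 1) (hS : S = Q * Matrix.diagonal μ * Q.transpose) {q : ℕ} (hq : 0 < q)
    (hqc : q < c) (hlead : ∀ i j : Fin c, (i : ℕ) < q → q ≤ (j : ℕ) → |μ j| ≤ |μ i|) :
    (∀ i : Fin c, (i : ℕ) < q → absEigenvalue S q ≤ |μ i|) ∧
      ∀ j : Fin c, q ≤ (j : ℕ) → |μ j| ≤ absEigenvalue S (q + 1) := by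
  let a : Multiset ℝ := (Finset.univ.filter fun i : Fin c => (i : ℕ) < q).val.map fun i => |μ i|
  let b : Multiset ℝ := (Finset.univ.filter fun i : Fin c => ¬ (i : ℕ) < q).val.map fun i => |μ i|
  have hab : S.charpoly.roots.map (fun t : ℝ => |t|) = a + b := by
    rw [roots_charpoly_of_orthogonal_conj hQ hS, Multiset.map_map, ← Multiset.map_add]
    congr 1
    exact (Multiset.filter_add_not _ _).symm
  have hcard : (a.sort (· ≥ ·)).length = q := by
    rw [Multiset.length_sort, Multiset.card_map, Finset.card_val, Fin.card_filter_val_lt,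
      min_eq_right hqc.le]
  have hsort : (S.charpoly.roots.map fun t : ℝ => |t|).sort (· ≥ ·) =
      a.sort (· ≥ ·) ++ b.sort (· ≥ ·) := by
    rw [hab]
    refine List.Perm.eq_of_pairwise' (r := (· ≥ ·)) (Multiset.pairwise_sort _ _)
      (List.pairwise_append.2 ⟨Multiset.pairwise_sort _ _, Multiset.pairwise_sort _ _, ?_⟩) ?_
    · intro s hs t ht
      rw [Multiset.mem_sort, Multiset.mem_map] at hs ht
      obtain ⟨i, hi, rfl⟩ := hs
      obtain ⟨j, hj, rfl⟩ := ht
      exact hlead i j (by simpa using hi) (by simpa using hj)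
    · rw [← Multiset.coe_eq_coe, Multiset.sort_eq, ← Multiset.coe_add, Multiset.sort_eq,
        Multiset.sort_eq]
  constructor
  · intro i hi
    have hmem : |μ i| ∈ a.sort (· ≥ ·) := by
      rw [Multiset.mem_sort, Multiset.mem_map]
      exact ⟨i, by simpa using hi, rfl⟩
    obtain ⟨k, hk, hki⟩ := List.getElem_of_mem hmem
    have h1 : absEigenvalue S q = (a.sort (· ≥ ·))[q - 1]'(by omega) := by
      unfold absEigenvalue
      rw [hsort, List.getD_append _ _ _ _ (by omega), List.getD_eq_getElem]
    rw [h1, ← hki]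
    exact (Multiset.pairwise_sort a (· ≥ ·)).rel_get_of_le (a := ⟨k, hk⟩) (b := ⟨q - 1, by omega⟩)
      (Fin.le_def.2 (by simp only; omega))
  · intro j hj
    have hmem : |μ j| ∈ b.sort (· ≥ ·) := by
      rw [Multiset.mem_sort, Multiset.mem_map]
      exact ⟨j, by simpa using hj, rfl⟩
    obtain ⟨k, hk, hkj⟩ := List.getElem_of_mem hmem
    have h1 : absEigenvalue S (q + 1) = (b.sort (· ≥ ·))[0]'(by omega) := by
      unfold absEigenvalue
      rw [hsort, List.getD_append_right _ _ _ _ (by omega)]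
      simp only [Nat.add_sub_cancel, hcard, Nat.sub_self]
      rw [List.getD_eq_getElem]
    rw [h1, ← hkj]
    exact (Multiset.pairwise_sort b (· ≥ ·)).rel_get_of_le (a := ⟨0, by omega⟩) (b := ⟨k, hk⟩)
      (Fin.le_def.2 (Nat.zero_le _))

end Eigenvalues

/-! ### Frobenius norms -/

section Frobenius

variable {m p : Type*} [Fintype m] [Fintype p]

theorem frobenius_norm_le_of_entries {A B : Matrix m p ℝ} (h : ∀ i j, |A i j| ≤ |B i j|) :
    ‖A‖ ≤ ‖B‖ := by
  rw [Matrix.frobenius_norm_def, Matrix.frobenius_norm_def]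
  refine Real.rpow_le_rpow (by positivity) ?_ (by norm_num)
  exact Finset.sum_le_sum fun i _ => Finset.sum_le_sum fun j _ =>
    Real.rpow_le_rpow (norm_nonneg _) (h i j) (by norm_num)

theorem frobenius_norm_real_smul (r : ℝ) (A : Matrix m p ℝ) : ‖r • A‖ = |r| * ‖A‖ :=
  letI : NormedSpace ℝ (Matrix m p ℝ) := Matrix.frobeniusNormedSpace
  norm_smul r A

theorem frobenius_norm_mul_diagonal_le [DecidableEq p] (A : Matrix m p ℝ) {μ : p → ℝ} {r : ℝ}
    (hr : 0 ≤ r) (h : ∀ k, |μ k| ≤ r) : ‖A * Matrix.diagonal μ‖ ≤ r * ‖A‖ := by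
  conv_rhs => rw [← abs_of_nonneg hr, ← frobenius_norm_real_smul]
  refine frobenius_norm_le_of_entries fun i j => ?_
  rw [Matrix.mul_diagonal, Matrix.smul_apply, smul_eq_mul, abs_mul, abs_mul, abs_of_nonneg hr,
    mul_comm]
  exact mul_le_mul_of_nonneg_right (h j) (abs_nonneg _)

theorem le_frobenius_norm_mul_diagonal [DecidableEq p] (A : Matrix m p ℝ) {μ : p → ℝ} {r : ℝ}
    (hr : 0 ≤ r) (h : ∀ k, r ≤ |μ k|) : r * ‖A‖ ≤ ‖A * Matrix.diagonal μ‖ := by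
  conv_lhs => rw [← abs_of_nonneg hr, ← frobenius_norm_real_smul]
  refine frobenius_norm_le_of_entries fun i j => ?_
  rw [Matrix.mul_diagonal, Matrix.smul_apply, smul_eq_mul, abs_mul, abs_mul, abs_of_nonneg hr,
    mul_comm]
  exact mul_le_mul_of_nonneg_left (h j) (abs_nonneg _)

end Frobenius

/-! ### The limit dynamics in the eigenbasis -/

section Spectral

variable {c : ℕ} {G : SimpleGraph (Fin c)} [DecidableRel G.Adj] {π : Fin c → ℝ}
  {Q : Matrix (Fin c) (Fin c) ℝ} {lam : Fin c → ℝ}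

theorem reweighted_symm (x y : Fin c) : reweighted G π x y = reweighted G π y x := by
  simp only [reweighted, Matrix.of_apply, SimpleGraph.adjMatrix_apply, G.adj_comm x y]
  ring

theorem rdegree_eq (y : Fin c) : rdegree G π y = π y * ∑ z ∈ G.neighborFinset y, π z := by
  rw [G.neighborFinset_eq_filter, Finset.sum_filter, Finset.mul_sum]
  refine Finset.sum_congr rfl fun z _ => ?_
  simp [reweighted, SimpleGraph.adjMatrix_apply]

theorem rdegree_pos (hπ : ∀ y, 0 < π y) (hadj : ∀ y, ∃ z, G.Adj y z) (y : Fin c) :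
    0 < rdegree G π y := by
  rw [rdegree_eq]
  exact mul_pos (hπ y) (Finset.sum_pos (fun z _ => hπ z)
    ((hadj y).imp fun z hz => (G.mem_neighborFinset y z).2 hz))

theorem normAdj_apply (x y : Fin c) : normAdj G π x y =
    (√(rdegree G π x))⁻¹ * reweighted G π x y * (√(rdegree G π y))⁻¹ := by
  rw [normAdj, Matrix.mul_diagonal, Matrix.diagonal_mul]

theorem IsEigendecomposition.mul_col {S : Matrix (Fin c) (Fin c) ℝ}
    (h : IsEigendecomposition S Q lam) (x i : Fin c) : ∑ y, S x y * Q y i = lam i * Q x i := by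
  have h1 : S * Q = Q * Matrix.diagonal lam := by
    rw [h.eq, mul_assoc, h.orthogonal, mul_one]
  have h2 := congrFun (congrFun h1 x) i
  rw [Matrix.mul_diagonal, Matrix.mul_apply] at h2
  rw [h2, mul_comm]

theorem IsEigendecomposition.smul_one_add {S : Matrix (Fin c) (Fin c) ℝ}
    (h : IsEigendecomposition S Q lam) (α β : ℝ) :
    α • (1 : Matrix (Fin c) (Fin c) ℝ) + β • S =
      Q * Matrix.diagonal (fun i => α + β * lam i) * Q.transpose := by
  have hd : Matrix.diagonal (fun i => α + β * lam i) =
      α • (1 : Matrix (Fin c) (Fin c) ℝ) + β • Matrix.diagonal lam := by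
    rw [← Matrix.diagonal_one, ← Matrix.diagonal_smul, ← Matrix.diagonal_smul,
      Matrix.diagonal_add]
    congr 1
    ext i
    simp
  rw [hd, h.eq, mul_add, add_mul, Matrix.mul_smul, Matrix.mul_smul, Matrix.smul_mul,
    Matrix.smul_mul, mul_one, mul_eq_one_comm.1 h.orthogonal]

/-- All eigenvectors but the first are orthogonal to the vector `√d`: by connectivity the eigenvalue
`1` of the normalized adjacency matrix is simple, so the first eigenvector is a multiple of `√d`. -/
theorem IsEigendecomposition.sum_sqrt_rdegree_mul (h : IsEigendecomposition (normAdj G π) Q lam)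
    (hG : G.Connected) (hπ : ∀ y, 0 < π y) (hadj : ∀ y, ∃ z, G.Adj y z) {i : Fin c}
    (hi : (i : ℕ) ≠ 0) : ∑ y, √(rdegree G π y) * Q y i = 0 := by
  let o : Fin c := ⟨0, by omega⟩
  have hs : ∀ y, 0 < √(rdegree G π y) := fun y => Real.sqrt_pos.2 (rdegree_pos hπ hadj y)
  let g : Fin c → ℝ := fun y => (√(rdegree G π y))⁻¹ * Q y o
  have hg : ∀ y, Q y o = √(rdegree G π y) * g y := by
    intro y
    simp only [g]
    rw [mul_inv_cancel_left₀ (hs y).ne']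
  have hharm : ∀ y, ∑ z, reweighted G π y z * g z = (∑ z, reweighted G π y z) * g y := by
    intro y
    have h1 := h.mul_col y o
    rw [h.first o rfl, one_mul] at h1
    have h2 : ∑ z, normAdj G π y z * Q z o =
        (√(rdegree G π y))⁻¹ * ∑ z, reweighted G π y z * g z := by
      rw [Finset.mul_sum]
      refine Finset.sum_congr rfl fun z _ => ?_
      rw [normAdj_apply]
      simp only [g]
      ring
    rw [h2, hg y, inv_mul_eq_iff_eq_mul₀ (hs y).ne', ← mul_assoc,
      Real.mul_self_sqrt (rdegree_pos hπ hadj y).le] at h1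
    exact h1
  have hconst := hG.eq_of_weighted_harmonic (a := fun y z => reweighted G π y z)
    (fun y z => by
      have := (hπ y).le
      have := (hπ z).le
      simp only [reweighted, Matrix.of_apply, SimpleGraph.adjMatrix_apply]
      positivity)
    (fun y z hyz => by
      have := hπ y
      have := hπ z
      simp only [reweighted, Matrix.of_apply, SimpleGraph.adjMatrix_apply, if_pos hyz]
      positivity) hharm
  have horth : ∀ j, ∑ y, Q y o * Q y j = if o = j then 1 else 0 := by
    intro j
    have := congrFun (congrFun h.orthogonal o) j
    simpa [Matrix.mul_apply, Matrix.one_apply] using this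
  have hcol : ∀ j, ∑ y, Q y o * Q y j = g o * ∑ y, √(rdegree G π y) * Q y j := by
    intro j
    rw [Finset.mul_sum]
    refine Finset.sum_congr rfl fun y _ => ?_
    rw [hg y, hconst y o]
    ring
  have hg0 : g o ≠ 0 := by
    intro h0
    have h1 := hcol o
    rw [horth, if_pos rfl, h0, zero_mul] at h1
    exact one_ne_zero h1
  have h1 := hcol i
  rw [horth, if_neg (fun hoi => hi (congrArg Fin.val hoi).symm)] at h1
  exact (mul_eq_zero.1 h1.symm).resolve_left hg0

/-- Averaging over the neighbors acts on `√d`-weighted coordinates as the normalized adjacency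
matrix, which the eigenvectors diagonalize. -/
theorem IsEigendecomposition.sum_neighbor_average (h : IsEigendecomposition (normAdj G π) Q lam)
    (hπ : ∀ y, 0 < π y) (hadj : ∀ y, ∃ z, G.Adj y z) (u : Fin c → ℝ) (i : Fin c) :
    ∑ y, (∑ z ∈ G.neighborFinset y, π z / (∑ z' ∈ G.neighborFinset y, π z') * u z) *
      √(rdegree G π y) * Q y i = lam i * ∑ y, u y * √(rdegree G π y) * Q y i := by
  have hs : ∀ y, 0 < √(rdegree G π y) := fun y => Real.sqrt_pos.2 (rdegree_pos hπ hadj y)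
  have h1 : ∀ y, (∑ z ∈ G.neighborFinset y, π z / (∑ z' ∈ G.neighborFinset y, π z') * u z) *
      √(rdegree G π y) = ∑ z, (√(rdegree G π y))⁻¹ * reweighted G π y z * u z := by
    intro y
    have hsum : ∑ z' ∈ G.neighborFinset y, π z' = rdegree G π y / π y := by
      rw [rdegree_eq, mul_div_cancel_left₀ _ (hπ y).ne']
    rw [hsum, Finset.sum_mul, G.neighborFinset_eq_filter, Finset.sum_filter]
    refine Finset.sum_congr rfl fun z _ => ?_
    have hd := Real.mul_self_sqrt (rdegree_pos hπ hadj y).le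
    have hsy := (hs y).ne'
    have hd0 := (rdegree_pos hπ hadj y).ne'
    have hπy := (hπ y).ne'
    simp only [reweighted, Matrix.of_apply, SimpleGraph.adjMatrix_apply]
    split_ifs
    · field_simp
      rw [pow_two, hd]
      ring
    · simp
  have h2 : ∀ z, ∑ y, (√(rdegree G π y))⁻¹ * reweighted G π y z * u z * Q y i =
      lam i * (u z * √(rdegree G π z) * Q z i) := by
    intro z
    have h3 := h.mul_col z i
    calc ∑ y, (√(rdegree G π y))⁻¹ * reweighted G π y z * u z * Q y i
        = u z * √(rdegree G π z) * ∑ y, normAdj G π z y * Q y i := by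
          rw [Finset.mul_sum]
          refine Finset.sum_congr rfl fun y _ => ?_
          rw [normAdj_apply, reweighted_symm z y]
          have := (hs z).ne'
          field_simp
      _ = _ := by rw [h3]; ring
  simp only [h1, Finset.sum_mul]
  rw [Finset.sum_comm, Finset.mul_sum]
  exact Finset.sum_congr rfl fun z _ => h2 z

theorem mat_mul_sqrtDeg_mul_submatrix_apply {d : ℕ} {p : Type*}
    (u : Fin c → EuclideanSpace ℝ (Fin d)) (f : p → Fin c) (i : Fin d) (k : p) :
    (mat u * sqrtDeg G π * Q.submatrix id f) i k =
      ∑ y, u y i * √(rdegree G π y) * Q y (f k) := by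
  rw [Matrix.mul_apply]
  refine Finset.sum_congr rfl fun y _ => ?_
  rw [sqrtDeg, Matrix.mul_diagonal]
  rfl

/-- In the eigenbasis, away from the first eigenvector, the attention step multiplies each column by
the corresponding eigenvalue of `ρA I + ρB M`: the contributions of the average over all tokens and
of the sink are multiples of `√d` and vanish. -/
theorem IsEigendecomposition.limitInput_mul (h : IsEigendecomposition (normAdj G π) Q lam)
    (hG : G.Connected) (hπ : ∀ y, 0 < π y) (hadj : ∀ y, ∃ z, G.Adj y z) {d : ℕ}
    (ρA ρB ρO ρT : ℝ) (s : EuclideanSpace ℝ (Fin d)) (u : Fin c → EuclideanSpace ℝ (Fin d))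
    {p : Type*} [Fintype p] [DecidableEq p] (f : p → Fin c) (hf : ∀ k, (f k : ℕ) ≠ 0) :
    mat (limitInput G π ρA ρB ρO ρT s u) * sqrtDeg G π * Q.submatrix id f =
      mat u * sqrtDeg G π * Q.submatrix id f *
        Matrix.diagonal fun k => ρA + ρB * lam (f k) := by
  ext i k
  rw [Matrix.mul_diagonal, mat_mul_sqrtDeg_mul_submatrix_apply,
    mat_mul_sqrtDeg_mul_submatrix_apply]
  have h1 := h.sum_neighbor_average hπ hadj (fun y => u y i) (f k)
  have h2 := h.sum_sqrt_rdegree_mul hG hπ hadj (hf k)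
  have h3 : ∀ y, limitInput G π ρA ρB ρO ρT s u y i * √(rdegree G π y) * Q y (f k) =
      ρA * (u y i * √(rdegree G π y) * Q y (f k)) +
      ρB * ((∑ z ∈ G.neighborFinset y, π z / (∑ z' ∈ G.neighborFinset y, π z') * u z i) *
        √(rdegree G π y) * Q y (f k)) +
      (ρO * (∑ z, (π z / ∑ z', π z') * u z i) + ρT * s i) * (√(rdegree G π y) * Q y (f k)) := by
    intro y
    simp only [limitInput, PiLp.add_apply, PiLp.smul_apply, smul_eq_mul, WithLp.ofLp_sum,
      Finset.sum_apply]
    ring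
  simp only [h3]
  rw [Finset.sum_add_distrib, Finset.sum_add_distrib, ← Finset.mul_sum, ← Finset.mul_sum,
    ← Finset.mul_sum, h1, h2]
  ring

end Spectral

end DoubleConvergence

/-! ### Contraction of the ratio of norms -/

namespace DoubleConvergence

section Contraction

variable {c : ℕ} {G : SimpleGraph (Fin c)} [DecidableRel G.Adj] {π : Fin c → ℝ}
  {Q : Matrix (Fin c) (Fin c) ℝ} {lam : Fin c → ℝ}

/-- One layer of the limit dynamics multiplies the ratio of the two norms by at most
`gapRatio * (γ₂' / γ₁)` and keeps the denominator nonzero. -/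
theorem IsEigendecomposition.layer_contraction
    (h : IsEigendecomposition (normAdj G π) Q lam) (hG : G.Connected) (hπ : ∀ y, 0 < π y)
    (hadj : ∀ y, ∃ z, G.Adj y z) {q : ℕ} (hq : 2 ≤ q) (hqc : q < c) {d : ℕ} {ρA ρB : ℝ}
    (ρO ρT : ℝ)
    (hlead : ∀ i j : Fin c, (i : ℕ) < q → q ≤ (j : ℕ) →
      |ρA + ρB * lam j| ≤ |ρA + ρB * lam i|)
    (h0 : absEigenvalue (ρA • (1 : Matrix (Fin c) (Fin c) ℝ) + ρB • normAdj G π) q ≠ 0)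
    {σ : EuclideanSpace ℝ (Fin d) → EuclideanSpace ℝ (Fin d)} {γ₁ γ₂ γ₁' γ₂' : ℝ}
    (hX : IsGreatMapping (sqrtDeg G π) σ γ₁ γ₂ Set.univ (blockX q Q))
    (hY : IsGreatMapping (sqrtDeg G π) σ γ₁' γ₂' Set.univ (blockY q Q))
    (s : EuclideanSpace ℝ (Fin d)) (u : Fin c → EuclideanSpace ℝ (Fin d))
    (hu : ‖mat u * sqrtDeg G π * blockX q Q‖ ≠ 0) :
    let u' := fun y => σ (limitInput G π ρA ρB ρO ρT s u y)
    let κ := gapRatio q (ρA • (1 : Matrix (Fin c) (Fin c) ℝ) + ρB • normAdj G π) * (γ₂' / γ₁)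
    0 ≤ κ ∧ ‖mat u' * sqrtDeg G π * blockX q Q‖ ≠ 0 ∧
      ‖mat u' * sqrtDeg G π * blockY q Q‖ / ‖mat u' * sqrtDeg G π * blockX q Q‖ ≤
        κ * (‖mat u * sqrtDeg G π * blockY q Q‖ / ‖mat u * sqrtDeg G π * blockX q Q‖) := by
  intro u' κ
  set S := ρA • (1 : Matrix (Fin c) (Fin c) ℝ) + ρB • normAdj G π with hS
  obtain ⟨hfirst, hlast⟩ := absEigenvalue_of_leading h.orthogonal (h.smul_one_add ρA ρB)
    (by omega) hqc hlead
  rw [← hS] at hfirst hlast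
  set α := absEigenvalue S q with hα
  set β := absEigenvalue S (q + 1) with hβ
  have hβ0 : 0 ≤ β := (abs_nonneg _).trans (hlast ⟨q, hqc⟩ le_rfl)
  have hα0 : 0 < α := lt_of_le_of_ne (absEigenvalue_nonneg S q) h0.symm
  set w := mat (limitInput G π ρA ρB ρO ρT s u) with hw
  have hu' : mat u' = colMap σ w := rfl
  have hwX : α * ‖mat u * sqrtDeg G π * blockX q Q‖ ≤ ‖w * sqrtDeg G π * blockX q Q‖ := by
    rw [hw, blockX, h.limitInput_mul hG hπ hadj ρA ρB ρO ρT s u _ fun k => by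
      have := k.2.1
      omega]
    exact le_frobenius_norm_mul_diagonal _ hα0.le fun k => hfirst _ k.2.2
  have hwY : ‖w * sqrtDeg G π * blockY q Q‖ ≤ β * ‖mat u * sqrtDeg G π * blockY q Q‖ := by
    rw [hw, blockY, h.limitInput_mul hG hπ hadj ρA ρB ρO ρT s u _ fun k => by
      have := k.2
      omega]
    exact frobenius_norm_mul_diagonal_le _ hβ0 fun k => hlast _ k.2
  have hX' := hX.lower w (Set.mem_univ _)
  have hY' := hY.upper w (Set.mem_univ _)
  rw [← hu'] at hX' hY'
  set a := ‖mat u * sqrtDeg G π * blockX q Q‖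
  set b := ‖mat u * sqrtDeg G π * blockY q Q‖
  have ha : 0 < a := lt_of_le_of_ne (norm_nonneg _) hu.symm
  have hγ := hX.pos₁
  have hγ' := hY.pos₂
  have hden : γ₁ * (α * a) ≤ ‖mat u' * sqrtDeg G π * blockX q Q‖ :=
    (mul_le_mul_of_nonneg_left hwX hγ.le).trans hX'
  have hnum : ‖mat u' * sqrtDeg G π * blockY q Q‖ ≤ γ₂' * (β * b) :=
    hY'.trans (mul_le_mul_of_nonneg_left hwY hγ'.le)
  have hpos : 0 < γ₁ * (α * a) := by positivity
  have hκ : κ = β / α * (γ₂' / γ₁) := rfl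
  refine ⟨by rw [hκ]; positivity, (hpos.trans_le hden).ne', ?_⟩
  calc ‖mat u' * sqrtDeg G π * blockY q Q‖ / ‖mat u' * sqrtDeg G π * blockX q Q‖
      ≤ γ₂' * (β * b) / (γ₁ * (α * a)) :=
        div_le_div₀ ((norm_nonneg _).trans hnum) hnum hpos hden
    _ = κ * (b / a) := by
        rw [hκ]
        field_simp

end Contraction

end DoubleConvergence

theorem mainTheorem2 {c : ℕ} (G : SimpleGraph (Fin c)) [DecidableRel G.Adj] (hG : G.Connected)
    (π : Fin c → ℝ) (hπ : IsStationaryDist G π)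
    {Ω : Type*} [MeasurableSpace Ω] (P : Measure Ω) [IsProbabilityMeasure P]
    (x : ℕ → Ω → Fin c) (hx : IsTokenProcess G π P x) :
    ∃ E : Set Ω, MeasurableSet E ∧ 0.99 ≤ P.real E ∧ ∀ ω ∈ E,
      ∀ (q : ℕ) (Q : Matrix (Fin c) (Fin c) ℝ) (lam : Fin c → ℝ),
      2 ≤ q → q < c → IsEigendecomposition (normAdj G π) Q lam →
      ∀ (ρA ρB ρO ρT ψA ψB ψO : ℕ → ℝ),
      (∀ ℓ, 0 ≤ ρA ℓ ∧ 0 ≤ ρB ℓ ∧ 0 ≤ ρO ℓ ∧ 0 ≤ ρT ℓ ∧ ρA ℓ + ρB ℓ + ρO ℓ + ρT ℓ = 1) →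
      (∀ ℓ, ∀ i j : Fin c, (i : ℕ) < q → q ≤ (j : ℕ) →
        |ρA ℓ + ρB ℓ * lam j| ≤ |ρA ℓ + ρB ℓ * lam i|) →
      ∀ (A : (n : ℕ) → ℕ → Matrix (Fin n) (Fin n) ℝ),
      (∀ n ℓ, 10 * c < n → IsMixedAttention G (fun i => x i ω)
        (ρA ℓ) (ρB ℓ) (ρO ℓ) (ρT ℓ) (ψA ℓ) (ψB ℓ) (ψO ℓ) (A n ℓ)) →
      ∀ (d : ℕ) (b : Fin c → EuclideanSpace ℝ (Fin d))
        (σ : ℕ → EuclideanSpace ℝ (Fin d) → EuclideanSpace ℝ (Fin d))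
        (γ₁ γ₂ γ₁' γ₂' : ℕ → ℝ) (ε : ℝ),
      mat b * sqrtDeg G π * blockX q Q ≠ 0 →
      (∀ ℓ, ∃ K, LipschitzWith K (σ ℓ)) →
      (∀ ℓ, IsGreatMapping (sqrtDeg G π) (σ ℓ) (γ₁ ℓ) (γ₂ ℓ) Set.univ (blockX q Q)) →
      (∀ ℓ, IsGreatMapping (sqrtDeg G π) (σ ℓ) (γ₁' ℓ) (γ₂' ℓ) Set.univ (blockY q Q)) →
      0 < ε →
      (∀ ℓ, absEigenvalue (ρA ℓ • (1 : Matrix (Fin c) (Fin c) ℝ) + ρB ℓ • normAdj G π) q ≠ 0 ∧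
        gapRatio q (ρA ℓ • (1 : Matrix (Fin c) (Fin c) ℝ) + ρB ℓ • normAdj G π) * (γ₂' ℓ / γ₁ ℓ) ≤ 1 - ε) →
      ∃ r : ℕ → ℝ,
        (∀ L,
          (∀ᶠ n in atTop, ‖lastOcc (fun i => x i ω) (hiddenRep (fun i => x i ω) b (A n) σ L) *
            sqrtDeg G π * blockX q Q‖ ≠ 0) ∧
          Tendsto (fun n =>
            ‖lastOcc (fun i => x i ω) (hiddenRep (fun i => x i ω) b (A n) σ L) *
              sqrtDeg G π * blockY q Q‖ /
            ‖lastOcc (fun i => x i ω) (hiddenRep (fun i => x i ω) b (A n) σ L) *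
              sqrtDeg G π * blockX q Q‖) atTop (𝓝 (r L))) ∧
        Tendsto r atTop (𝓝 0) := by
  rcases lt_or_ge c 2 with hc | hc
  · -- With fewer than two tokens there is no `q` with `2 ≤ q < c`.
    refine ⟨Set.univ, MeasurableSet.univ, by simp; norm_num, ?_⟩
    intro ω _ q Q lam hq hqc
    omega
  have hpos := hπ.pos hG
  have hadj := hG.exists_adj_of_two_le hc
  have hae : ∀ᵐ ω ∂P, ∀ y, Tendsto (fun k : ℕ => (freq (fun i => x i ω) k y : ℝ) / (k + 1)) atTop
      (𝓝 (π y)) := ae_all_iff.2 fun y => hx.ae_tendsto_freq hπ hG hc y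
  -- The exceptional set need not be known to be measurable: a measurable null superset is removed.
  refine ⟨(toMeasurable P {ω | ∀ y, Tendsto (fun k : ℕ => (freq (fun i => x i ω) k y : ℝ) / (k + 1))
    atTop (𝓝 (π y))}ᶜ)ᶜ, (measurableSet_toMeasurable _ _).compl, ?_, ?_⟩
  · rw [probReal_compl_eq_one_sub (measurableSet_toMeasurable _ _), measureReal_def,
      measure_toMeasurable, mem_ae_iff.1 hae]
    norm_num
  intro ω hω q Q lam hq hqc hQ ρA ρB ρO ρT ψA ψB ψO hρ hlead A hA d b σ γ₁ γ₂ γ₁' γ₂' ε hb hσ hX hY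
    hε hgap
  have hfreq : ∀ y, Tendsto (fun k : ℕ => (freq (fun i => x i ω) k y : ℝ) / (k + 1))
      atTop (𝓝 (π y)) := by
    by_contra hnot
    exact hω (subset_toMeasurable _ _ hnot)
  set u := limitRep G π ρA ρB ρO ρT b (b (x 0 ω)) σ with hu
  have hlim : ∀ L, Tendsto (fun n => lastOcc (fun i => x i ω)
      (hiddenRep (fun i => x i ω) b (A n) σ L)) atTop (𝓝 (mat (u L))) := fun L =>
    (tokenLimit_hiddenRep hfreq hpos hadj (fun ℓ => (hρ ℓ).2.2.2.2) hA b hσ L).tendsto_lastOcc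
      fun y => frequently_eq_of_tendsto_freq (hfreq y) (hpos y)
  have hcontX : Continuous fun Z : Matrix (Fin d) (Fin c) ℝ =>
      ‖Z * sqrtDeg G π * blockX q Q‖ :=
    continuous_norm.comp
      ((continuous_id.matrix_mul continuous_const).matrix_mul continuous_const)
  have hcontY : Continuous fun Z : Matrix (Fin d) (Fin c) ℝ =>
      ‖Z * sqrtDeg G π * blockY q Q‖ :=
    continuous_norm.comp
      ((continuous_id.matrix_mul continuous_const).matrix_mul continuous_const)
  have hstep := fun ℓ => hQ.layer_contraction hG hpos hadj hq hqc (ρO ℓ) (ρT ℓ) (hlead ℓ)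
    (hgap ℓ).1 (hX ℓ) (hY ℓ) (sinkRep (b (x 0 ω)) σ ℓ) (u ℓ)
  have hne : ∀ L, ‖mat (u L) * sqrtDeg G π * blockX q Q‖ ≠ 0 := by
    intro L
    induction L with
    | zero => exact norm_ne_zero_iff.2 hb
    | succ ℓ ih => exact (hstep ℓ ih).2.1
  set r : ℕ → ℝ := fun L => ‖mat (u L) * sqrtDeg G π * blockY q Q‖ /
    ‖mat (u L) * sqrtDeg G π * blockX q Q‖ with hr
  have hr0 : ∀ L, 0 ≤ r L := fun L => div_nonneg (norm_nonneg _) (norm_nonneg _)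
  have hε1 : 0 ≤ 1 - ε := (hstep 0 (hne 0)).1.trans (hgap 0).2
  have hrle : ∀ L, r L ≤ (1 - ε) ^ L * r 0 := by
    intro L
    induction L with
    | zero => simp
    | succ ℓ ih =>
      calc r (ℓ + 1) ≤ _ := (hstep ℓ (hne ℓ)).2.2
        _ ≤ (1 - ε) * r ℓ := mul_le_mul_of_nonneg_right (hgap ℓ).2 (hr0 ℓ)
        _ ≤ (1 - ε) * ((1 - ε) ^ ℓ * r 0) := mul_le_mul_of_nonneg_left ih hε1
        _ = (1 - ε) ^ (ℓ + 1) * r 0 := by ring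
  refine ⟨r, fun L => ⟨?_, ?_⟩, ?_⟩
  · exact ((hcontX.tendsto _).comp (hlim L)).eventually_ne (hne L)
  · exact ((hcontY.tendsto _).comp (hlim L)).div ((hcontX.tendsto _).comp (hlim L)) (hne L)
  · refine squeeze_zero hr0 hrle ?_
    have := (tendsto_pow_atTop_nhds_zero_of_lt_one hε1 (by linarith)).mul_const (r 0)
    rwa [zero_mul] at this
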